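/- Let $\mathbb{D}=\{z\in\mathbb{C}:|z|<1\}$. Let $f:\overline{\mathbb{D}}\to\mathbb{C}$ be a continuous map that fixes every point of $\partial\mathbb{D}$, and whose restriction to $\mathbb{D}$ is a quasiconformal map of $\mathbb{D}$ onto itself; that is, $f|_{\mathbb{D}}$ is a homeomorphism of $\mathbb{D}$ onto $\mathbb{D}$, is absolutely continuous on lines (for every closed rectangle with sides parallel to the axes contained in $\mathbb{D}$, $f$ is absolutely continuous on almost every horizontal and almost every vertical segment of the rectangle), and satisfies, for some finite $K\ge 1$, $|\partial_{\bar z}f|\le \frac{K-1}{K+1}\,|\partial_z f|$ almost everywhere in $\mathbb{D}$. Let $$K_f=\operatorname*{ess\,sup}_{z\in\mathbb{D}}\frac{|\partial_z f(z)|+|\partial_{\bar z}f(z)|}{|\partial_z f(z)|-|\partial_{\bar z}f(z)|}$$ be its quasiconformal dilatation. If $f(0)$ is real and $f(0)\in(-1,0]$, then $$|f(0)|\le 2\left(K_f^{1/2}-1\right).$$ -/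

import Mathlib

open MeasureTheory Set

noncomputable section

/-- The Wirtinger derivative `∂f = (∂_x f - i ∂_y f) / 2`, through the partial derivatives of `f`. -/
def dz (f : ℂ → ℂ) (z : ℂ) : ℂ :=
  (lineDeriv ℝ f z 1 - Complex.I * lineDeriv ℝ f z Complex.I) / 2

/-- The Wirtinger derivative `∂̄f = (∂_x f + i ∂_y f) / 2`, through the partial derivatives of `f`. -/
def dzbar (f : ℂ → ℂ) (z : ℂ) : ℂ :=
  (lineDeriv ℝ f z 1 + Complex.I * lineDeriv ℝ f z Complex.I) / 2

/-- `f` is absolutely continuous on lines in `Ω`: for every closed rectangle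
`[a, b] × [c, d]` contained in `Ω`, `f` is absolutely continuous on almost every horizontal and
on almost every vertical segment of the rectangle. -/
def ACL (f : ℂ → ℂ) (Ω : Set ℂ) : Prop :=
  ∀ a b c d : ℝ, a < b → c < d → Icc a b ×ℂ Icc c d ⊆ Ω →
    (∀ᵐ y : ℝ, y ∈ Icc c d →
      AbsolutelyContinuousOnInterval (fun x : ℝ => f (x + y * Complex.I)) a b) ∧
    (∀ᵐ x : ℝ, x ∈ Icc a b →
      AbsolutelyContinuousOnInterval (fun y : ℝ => f (x + y * Complex.I)) c d)

/-- The analytic definition of a `K`-quasiconformal map on the open set `Ω`. Only the values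
of `f` on `Ω` matter. -/
structure IsKQuasiconformalOn (K : ℝ) (f : ℂ → ℂ) (Ω : Set ℂ) : Prop where
  one_le : 1 ≤ K
  isOpen : IsOpen Ω
  /-- `f` is a homeomorphism from `Ω` onto its image `f(Ω)`. -/
  homeo : Topology.IsEmbedding (Ω.domRestrict f)
  acl : ACL f Ω
  dilatation : ∀ᵐ z ∂(volume.restrict Ω), ‖dzbar f z‖ ≤ (K - 1) / (K + 1) * ‖dz f z‖

/-- `f` is quasiconformal on `Ω` if it is `K`-quasiconformal for some finite `K ≥ 1`. -/
def IsQuasiconformalOn (f : ℂ → ℂ) (Ω : Set ℂ) : Prop :=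
  ∃ K : ℝ, IsKQuasiconformalOn K f Ω

/-- The quasiconformal dilatation `K_f` of a map `f` that is quasiconformal on `Ω`:
the essential supremum over `Ω` of `(|∂f| + |∂̄f|) / (|∂f| - |∂̄f|)`. -/
def qcDilatation (f : ℂ → ℂ) (Ω : Set ℂ) : ℝ :=
  essSup (fun z => (‖dz f z‖ + ‖dzbar f z‖) / (‖dz f z‖ - ‖dzbar f z‖)) (volume.restrict Ω)

end

/-!
The proof is a length-area argument on the double covers of the disc branched at `0` and at `f 0`.
Write `f 0 = -r` with `0 ≤ r < 1`. In the coordinates `w = √z` on the source and `√(ζ + r)` on the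
target, `f` lifts to `F(w) = √(f(w²) + r)`. The known boundary values of `F` make the mean
horizontal displacement of `F` along horizontal chords larger than that of the identity by exactly
the factor `1 + r / 2`, while the area of the target cover does not exceed that of the source
cover. Comparing length and area gives `1 + r / 2 ≤ √K`.

To avoid Sobolev theory on the cover, everything is written on the disc itself. The function
`S = F / w = √((f z + r) / z)` is single-valued on the punctured plane (`exists_sqrt_div`), and the
one-form `F d(Im w) = (S dz - S (z / |z|) dz̄) / (4 i)` has as its exterior derivative
`(∂̄f / (z S) + ∂f / (|z| S)) / 4` times the area form (`rootFormDeriv_sub_eq`). Since `f` is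
absolutely continuous on almost every line, the fundamental theorem of calculus on chords
and Fubini's theorem (`integral_ball_rootFormDeriv`) give Green's formula, where the
singularity at the origin only affects a null set of lines. The boundary integral equals
`(π / 2) (1 + r / 2)` by Cauchy's formula (`integral_curl_eq`).

For the upper bound, `(|∂f| + |∂̄f|)² ≤ K J` and the arithmetic-geometric mean inequality bound the
integral of the exterior derivative by `(√K / 8) (∫ 1 / |z| + ∫ J / |f + r|)`. The first integral
is `2 π`. The second is at most `∫ 1 / |ζ + r| ≤ 2 π` by the area inequality
(`lintegral_jacobian_mul_le`), which only needs that `f` is injective, continuous and has partial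
derivatives almost everywhere: off a set of small measure the difference quotients in one direction
converge uniformly, and there `f` is differentiable relative to the remaining set.
-/

open scoped Topology ComplexConjugate ENNReal

/-! ### Absolutely continuous functions on intervals -/

theorem AbsolutelyContinuousOnInterval.congr {f g : ℝ → ℂ} {a b : ℝ}
    (hf : AbsolutelyContinuousOnInterval f a b) (h : EqOn g f (uIcc a b)) :
    AbsolutelyContinuousOnInterval g a b := by
  rw [absolutelyContinuousOnInterval_iff] at hf ⊢
  intro ε hε
  obtain ⟨δ, hδ, H⟩ := hf ε hε
  refine ⟨δ, hδ, fun E hE hlen => ?_⟩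
  refine lt_of_eq_of_lt (Finset.sum_congr rfl fun i hi => ?_) (H E hE hlen)
  rw [h (hE.1 i hi).1, h (hE.1 i hi).2]

/-- A continuous square root of a nonvanishing absolutely continuous function is absolutely
continuous: `S s - S t = (u s - u t) / (S s + S t)`, and the denominator is bounded below for
close `s` and `t`. -/
theorem AbsolutelyContinuousOnInterval.of_sq_eq {u S : ℝ → ℂ} {a b : ℝ}
    (hu : AbsolutelyContinuousOnInterval u a b) (hS : ContinuousOn S (uIcc a b))
    (hsq : ∀ t ∈ uIcc a b, S t ^ 2 = u t) (hne : ∀ t ∈ uIcc a b, S t ≠ 0) :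
    AbsolutelyContinuousOnInterval S a b := by
  obtain ⟨t₀, ht₀, hmin⟩ := isCompact_uIcc.exists_isMinOn nonempty_uIcc hS.norm
  set m := ‖S t₀‖ with hm
  have hm0 : 0 < m := norm_pos_iff.2 (hne _ ht₀)
  have hmin' : ∀ t ∈ uIcc a b, m ≤ ‖S t‖ := fun t ht => hmin ht
  have hunif := isCompact_uIcc.uniformContinuousOn_of_continuous hS
  rw [Metric.uniformContinuousOn_iff] at hunif
  obtain ⟨δ₁, hδ₁, h₁⟩ := hunif m hm0
  rw [absolutelyContinuousOnInterval_iff] at hu ⊢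
  intro ε hε
  obtain ⟨δ₂, hδ₂, h₂⟩ := hu (ε * m) (by positivity)
  refine ⟨min δ₁ δ₂, lt_min hδ₁ hδ₂, fun E hE hlen => ?_⟩
  have hkey : ∀ i ∈ Finset.range E.1,
      dist (S (E.2 i).1) (S (E.2 i).2) ≤ dist (u (E.2 i).1) (u (E.2 i).2) / m := by
    intro i hi
    obtain ⟨hx, hy⟩ := hE.1 i hi
    have hd : dist (E.2 i).1 (E.2 i).2 < δ₁ := by
      refine lt_of_le_of_lt ?_ (hlen.trans_le (min_le_left _ _))
      exact Finset.single_le_sum (f := fun i => dist (E.2 i).1 (E.2 i).2)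
        (fun _ _ => dist_nonneg) hi
    have hclose := h₁ _ hx _ hy hd
    set x := (E.2 i).1
    set y := (E.2 i).2
    rw [dist_eq_norm] at hclose
    have hsum : m ≤ ‖S x + S y‖ := by
      have h2 : (2 : ℂ) * S x = (S x + S y) + (S x - S y) := by ring
      have h3 : 2 * ‖S x‖ ≤ ‖S x + S y‖ + ‖S x - S y‖ := by
        have := norm_add_le (S x + S y) (S x - S y)
        rw [← h2, norm_mul] at this
        simpa using this
      linarith [hmin' x hx]
    rw [le_div_iff₀ hm0, dist_eq_norm, dist_eq_norm, ← hsq x hx, ← hsq y hy, sq_sub_sq, norm_mul,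
      mul_comm]
    gcongr
  calc ∑ i ∈ Finset.range E.1, dist (S (E.2 i).1) (S (E.2 i).2)
      ≤ ∑ i ∈ Finset.range E.1, dist (u (E.2 i).1) (u (E.2 i).2) / m := Finset.sum_le_sum hkey
    _ = (∑ i ∈ Finset.range E.1, dist (u (E.2 i).1) (u (E.2 i).2)) / m := by
        rw [Finset.sum_div]
    _ < ε := by
        rw [div_lt_iff₀ hm0]
        exact h₂ E hE (hlen.trans_le (min_le_right _ _))

theorem hasDerivAt_of_sq_eq {u S : ℝ → ℂ} {u' : ℂ} {t : ℝ} (hu : HasDerivAt u u' t)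
    (hS : ContinuousAt S t) (hsq : ∀ᶠ s in 𝓝 t, S s ^ 2 = u s) (hne : S t ≠ 0) :
    HasDerivAt S (u' / (2 * S t)) t := by
  rw [hasDerivAt_iff_tendsto_slope] at hu ⊢
  have hsum : Filter.Tendsto (fun s => S s + S t) (𝓝[≠] t) (𝓝 (2 * S t)) := by
    rw [two_mul]
    exact (hS.tendsto.mono_left nhdsWithin_le_nhds).add tendsto_const_nhds
  refine (hu.div hsum (by simpa using hne)).congr' ?_
  have hev : ∀ᶠ s in 𝓝[≠] t, S s + S t ≠ 0 :=
    hsum.eventually_ne (by simpa using hne)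
  filter_upwards [hev, hsq.filter_mono nhdsWithin_le_nhds] with s hs hs2
  rw [Pi.div_apply, slope_def_module, slope_def_module, ← hs2, ← hsq.self_of_nhds]
  rw [sq_sub_sq, div_eq_iff hs, smul_mul_assoc, mul_comm]

theorem AbsolutelyContinuousOnInterval.comp_lipschitz {f : ℝ → ℂ} {g : ℂ → ℝ} {a b : ℝ}
    (hf : AbsolutelyContinuousOnInterval f a b) (hg : LipschitzWith 1 g) :
    AbsolutelyContinuousOnInterval (fun t => g (f t)) a b := by
  refine squeeze_zero (fun t => Finset.sum_nonneg fun i _ => dist_nonneg) (fun t => ?_) hf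
  exact Finset.sum_le_sum fun i _ => by simpa using hg.dist_le_mul (f (t.2 i).1) (f (t.2 i).2)

theorem AbsolutelyContinuousOnInterval.ae_differentiableAt_complex {f : ℝ → ℂ} {a b : ℝ}
    (hf : AbsolutelyContinuousOnInterval f a b) :
    ∀ᵐ t, t ∈ uIcc a b → DifferentiableAt ℝ f t := by
  have h1 := hf.boundedVariationOn.locallyBoundedVariationOn.ae_differentiableWithinAt_of_mem
  have h2 : ∀ᵐ t : ℝ, t ≠ a ∧ t ≠ b := by
    have := (Set.toFinite {a, b}).countable.ae_notMem volume
    filter_upwards [this] with t ht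
    simpa using ht
  filter_upwards [h1, h2] with t ht1 ht2 ht
  refine (ht1 ht).differentiableAt ?_
  rw [uIcc, Icc_mem_nhds_iff]
  rw [uIcc, mem_Icc] at ht
  constructor
  · refine lt_of_le_of_ne ht.1 ?_
    rcases min_choice a b with h | h <;> rw [h]
    exacts [ht2.1.symm, ht2.2.symm]
  · refine lt_of_le_of_ne ht.2 ?_
    rcases max_choice a b with h | h <;> rw [h]
    exacts [ht2.1, ht2.2]

theorem lineDeriv_line (f : ℂ → ℂ) (c v : ℂ) (t : ℝ) :
    lineDeriv ℝ f (c + t * v) v = deriv (fun s : ℝ => f (c + s * v)) t := by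
  rw [lineDeriv]
  have := deriv_comp_const_add (fun s : ℝ => f (c + s * v)) t 0
  rw [add_zero] at this
  rw [← this]
  congr 1
  funext s
  simp only [Complex.real_smul]
  push_cast
  ring_nf

theorem lineDifferentiableAt_line {f : ℂ → ℂ} {c v : ℂ} {t : ℝ}
    (h : DifferentiableAt ℝ (fun s : ℝ => f (c + s * v)) t) :
    LineDifferentiableAt ℝ f (c + t * v) v := by
  have h' : DifferentiableAt ℝ (fun s : ℝ => f (c + s * v)) (t + 0) := by rwa [add_zero]
  have e : (fun s : ℝ => f (c + t * v + s • v)) =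
      (fun s : ℝ => f (c + s * v)) ∘ fun s : ℝ => t + s := by
    funext s
    simp only [Complex.real_smul, Function.comp]
    push_cast
    ring_nf
  rw [LineDifferentiableAt, e]
  exact h'.comp (0 : ℝ) (f := fun s : ℝ => t + s) (by fun_prop)

/-- The fundamental theorem of calculus for complex-valued absolutely continuous functions. -/
theorem AbsolutelyContinuousOnInterval.integral_eq_sub_of_ae_hasDerivAt {R R' : ℝ → ℂ} {a b : ℝ}
    (hR : AbsolutelyContinuousOnInterval R a b)
    (hd : ∀ᵐ t, t ∈ uIcc a b → HasDerivAt R (R' t) t) :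
    IntervalIntegrable R' volume a b ∧ ∫ t in a..b, R' t = R b - R a := by
  have hre : LipschitzWith 1 Complex.re := by
    simpa using LipschitzWith.of_dist_le_mul (K := 1) (f := Complex.re) fun x y => by
      simpa [dist_eq_norm, Real.norm_eq_abs] using Complex.abs_re_le_norm (x - y)
  have him : LipschitzWith 1 Complex.im := by
    simpa using LipschitzWith.of_dist_le_mul (K := 1) (f := Complex.im) fun x y => by
      simpa [dist_eq_norm, Real.norm_eq_abs] using Complex.abs_im_le_norm (x - y)
  have hR1 := hR.comp_lipschitz hre
  have hR2 := hR.comp_lipschitz him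
  have e1 : ∀ᵐ t, t ∈ uIoc a b → deriv (fun t => (R t).re) t = (R' t).re := by
    filter_upwards [hd] with t ht hab
    exact (Complex.reCLM.hasFDerivAt.comp_hasDerivAt t (ht (uIoc_subset_uIcc hab))).deriv
  have e2 : ∀ᵐ t, t ∈ uIoc a b → deriv (fun t => (R t).im) t = (R' t).im := by
    filter_upwards [hd] with t ht hab
    exact (Complex.imCLM.hasFDerivAt.comp_hasDerivAt t (ht (uIoc_subset_uIcc hab))).deriv
  have i1 : IntervalIntegrable (fun t => (R' t).re) volume a b :=
    hR1.intervalIntegrable_deriv.congr_ae ((ae_restrict_iff' measurableSet_uIoc).2 e1)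
  have i2 : IntervalIntegrable (fun t => (R' t).im) volume a b :=
    hR2.intervalIntegrable_deriv.congr_ae ((ae_restrict_iff' measurableSet_uIoc).2 e2)
  have hdec : R' = fun t => ((R' t).re : ℂ) + ((R' t).im : ℂ) * Complex.I := by
    funext t; simp
  have i1' : IntervalIntegrable (fun t => ((R' t).re : ℂ)) volume a b :=
    ⟨i1.1.ofReal, i1.2.ofReal⟩
  have i2' : IntervalIntegrable (fun t => ((R' t).im : ℂ) * Complex.I) volume a b :=
    IntervalIntegrable.mul_const ⟨i2.1.ofReal, i2.2.ofReal⟩ _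
  refine ⟨by rw [hdec]; exact i1'.add i2', ?_⟩
  have f1 : ∫ t in a..b, (R' t).re = (R b).re - (R a).re := by
    rw [← hR1.integral_deriv_eq_sub]
    exact (intervalIntegral.integral_congr_ae e1).symm
  have f2 : ∫ t in a..b, (R' t).im = (R b).im - (R a).im := by
    rw [← hR2.integral_deriv_eq_sub]
    exact (intervalIntegral.integral_congr_ae e2).symm
  rw [hdec, intervalIntegral.integral_add i1' i2', intervalIntegral.integral_mul_const,
    intervalIntegral.integral_ofReal, intervalIntegral.integral_ofReal, f1, f2]
  apply Complex.ext <;> simp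

/-! ### The derivative of the square root along lines -/

/-- The formal derivative in the direction `v` of `S z * (α + β * z / |z|)`, where
`z * S z ^ 2 - f z` is constant. The derivative of `S` is expressed through that of `f`. -/
noncomputable def rootFormDeriv (f S : ℂ → ℂ) (α β v z : ℂ) : ℂ :=
  (lineDeriv ℝ f z v - v * S z ^ 2) / (2 * z * S z) * (α + β * (z / ‖z‖)) +
    S z * (β * (v / ‖z‖ - z * ((z * conj v).re : ℂ) / (‖z‖ : ℂ) ^ 3))

theorem hasDerivAt_div_norm (c v : ℂ) (t : ℝ) (h : c + t * v ≠ 0) :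
    HasDerivAt (fun t : ℝ => (c + t * v) / (‖c + t * v‖ : ℂ))
      (v / ‖c + t * v‖ - (c + t * v) * (((c + t * v) * conj v).re : ℂ) / (‖c + t * v‖ : ℂ) ^ 3)
      t := by
  have hp : HasDerivAt (fun t : ℝ => c + t * v) v t := by
    simpa using ((Complex.ofRealCLM.hasDerivAt (x := t)).mul_const v).const_add c
  have hn0 : ‖c + t * v‖ ≠ 0 := norm_ne_zero_iff.2 h
  have hsq : HasDerivAt (fun t : ℝ => ‖c + t * v‖ ^ 2) (2 * ((c + t * v) * conj v).re) t := by
    have := hp.norm_sq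
    convert this using 2
    rw [Complex.inner]
    simp [Complex.mul_re]; ring
  have hn : HasDerivAt (fun t : ℝ => ‖c + t * v‖) (((c + t * v) * conj v).re / ‖c + t * v‖) t := by
    have := hsq.sqrt (by positivity)
    simp only [Real.sqrt_sq (norm_nonneg _)] at this
    convert this using 1
    field_simp
  have hnc := hn.ofReal_comp
  have hn0' : ((‖c + t * v‖ : ℝ) : ℂ) ≠ 0 := by exact_mod_cast hn0
  refine (hp.div hnc hn0').congr_deriv ?_
  push_cast
  field_simp

/-- The fundamental theorem of calculus for `S z * (α + β * z / |z|)` on a segment that avoids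
the origin and on which `f` is absolutely continuous. -/
theorem integral_rootFormDeriv {f S : ℂ → ℂ} {w α β c v : ℂ} {a b : ℝ}
    (hS : ContinuousOn S {0}ᶜ) (hsq : ∀ z ≠ 0, z * S z ^ 2 = f z + w)
    (hS0 : ∀ z ≠ 0, S z ≠ 0)
    (hne : ∀ t : ℝ, c + t * v ≠ 0)
    (hf : AbsolutelyContinuousOnInterval (fun t : ℝ => f (c + t * v)) a b) :
    IntervalIntegrable (fun t : ℝ => rootFormDeriv f S α β v (c + t * v)) volume a b ∧
    ∫ t in a..b, rootFormDeriv f S α β v (c + t * v) =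
      S (c + b * v) * (α + β * ((c + b * v) / ‖c + b * v‖)) -
      S (c + a * v) * (α + β * ((c + a * v) / ‖c + a * v‖)) := by
  have hpc : Continuous fun t : ℝ => c + t * v := by fun_prop
  have hSc : Continuous fun t : ℝ => S (c + t * v) :=
    hS.comp_continuous hpc fun t => hne t
  have hsq' : ∀ t : ℝ, S (c + t * v) ^ 2 = (c + t * v)⁻¹ * (f (c + t * v) + w) := fun t => by
    rw [← hsq _ (hne t)]; field_simp [hne t]
  have hpd : ContDiff ℝ 1 fun t : ℝ => c + t * v := by
    have : ContDiff ℝ 1 (fun t : ℝ => (t : ℂ)) := Complex.ofRealCLM.contDiff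
    fun_prop
  have ac_const : ∀ k : ℂ, AbsolutelyContinuousOnInterval (fun _ : ℝ => k) a b := fun k =>
    (contDiff_const (n := 1)).contDiffOn.absolutelyContinuousOnInterval
  have ac_inv : AbsolutelyContinuousOnInterval (fun t : ℝ => (c + t * v)⁻¹) a b :=
    (hpd.inv hne).contDiffOn.absolutelyContinuousOnInterval
  have ac_T : AbsolutelyContinuousOnInterval
      (fun t : ℝ => (c + t * v) / (‖c + t * v‖ : ℂ)) a b := by
    have hn : ContDiff ℝ 1 fun t : ℝ => ‖c + t * v‖ := hpd.norm ℝ hne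
    have hn' : ContDiff ℝ 1 fun t : ℝ => (‖c + t * v‖ : ℂ) := Complex.ofRealCLM.contDiff.comp hn
    simp only [div_eq_mul_inv]
    exact (hpd.mul (hn'.inv fun t => Complex.ofReal_ne_zero.2
      (norm_ne_zero_iff.2 (hne t)))).contDiffOn.absolutelyContinuousOnInterval
  have ac_u : AbsolutelyContinuousOnInterval
      (fun t : ℝ => (c + t * v)⁻¹ * (f (c + t * v) + w)) a b := ac_inv.smul (hf.add (ac_const w))
  have ac_S : AbsolutelyContinuousOnInterval (fun t : ℝ => S (c + t * v)) a b :=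
    ac_u.of_sq_eq hSc.continuousOn (fun t _ => hsq' t) fun t _ => hS0 _ (hne t)
  have ac_R : AbsolutelyContinuousOnInterval
      (fun t : ℝ => S (c + t * v) * (α + β * ((c + t * v) / (‖c + t * v‖ : ℂ)))) a b :=
    ac_S.smul ((ac_const α).add ((ac_const β).smul ac_T))
  refine ac_R.integral_eq_sub_of_ae_hasDerivAt ?_
  filter_upwards [hf.ae_differentiableAt_complex] with t ht htab
  have hft := (ht htab).hasDerivAt
  rw [← lineDeriv_line] at hft
  have hp : HasDerivAt (fun t : ℝ => c + t * v) v t := by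
    simpa using ((Complex.ofRealCLM.hasDerivAt (x := t)).mul_const v).const_add c
  have hu := (hp.inv (hne t)).mul (hft.add_const w)
  have hSd := hasDerivAt_of_sq_eq hu hSc.continuousAt
    (Filter.Eventually.of_forall fun s => hsq' s) (hS0 _ (hne t))
  have hT := hasDerivAt_div_norm c v t (hne t)
  refine (hSd.mul ((hT.const_mul β).const_add α)).congr_deriv ?_
  simp only [rootFormDeriv]
  congr 1
  congr 1
  have h0 := hne t
  have hs0 := hS0 _ h0
  rw [← hsq _ h0]
  simp only [Pi.inv_apply]
  field_simp
  ring

/-! ### A single-valued square root on the punctured plane -/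

theorem exists_continuous_log {q : ℂ → ℂ} (hq : Continuous q) (h0 : ∀ z, q z ≠ 0) :
    ∃ L : ℂ → ℂ, Continuous L ∧ ∀ z, Complex.exp (L z) = q z := by
  obtain ⟨L, hL, -⟩ := Complex.isCoveringMapOn_exp.existsUnique_continuousMap_lifts
    (⟨q, hq⟩ : C(ℂ, ℂ)) (a₀ := 0) (e₀ := Complex.log (q 0)) (Complex.exp_log (h0 0))
    (fun a => h0 a)
  exact ⟨L, L.continuous, fun z => congrFun hL.2 z⟩

/-- A continuous function with values in `2πiℤ` is constant on a preconnected set. -/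
theorem IsPreconnected.exp_eq_one_const {X : Type*} [TopologicalSpace X] {s : Set X}
    (hs : IsPreconnected s) {d : X → ℂ} (hd : ContinuousOn d s)
    (h1 : ∀ x ∈ s, Complex.exp (d x) = 1) {x y : X} (hx : x ∈ s) (hy : y ∈ s) : d x = d y := by
  have hpi : (2 * Real.pi * Complex.I : ℂ) ≠ 0 := Complex.two_pi_I_ne_zero
  have hint : ∀ x ∈ s, ∃ n : ℤ, d x = n * (2 * Real.pi * Complex.I) := fun x hx =>
    Complex.exp_eq_one_iff.1 (h1 x hx)
  have hmem : MapsTo (fun x => (d x / (2 * Real.pi * Complex.I)).re) s (range ((↑) : ℤ → ℝ)) := by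
    intro x hx
    obtain ⟨n, hn⟩ := hint x hx
    exact ⟨n, by simp [hn, hpi]⟩
  have hc : ContinuousOn (fun x => (d x / (2 * Real.pi * Complex.I)).re) s :=
    Complex.continuous_re.comp_continuousOn (hd.div_const _)
  have hdisc : IsDiscrete (range ((↑) : ℤ → ℝ)) :=
    
    Int.isClosedEmbedding_coe_real.isInducing.isDiscrete_range
  have := hs.constant_of_mapsTo hdisc hc hmem hx hy
  obtain ⟨n, hn⟩ := hint x hx
  obtain ⟨m, hm⟩ := hint y hy
  rw [hn, hm] at this ⊢
  simp only [mul_div_assoc, div_self hpi] at this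
  simp at this
  rw [this]

/-- The square root of `(g z + r) / z` is well defined on the punctured plane: outside the unit
disc the quotient is `1 + r / z`, which stays in the right half-plane, so it does not wind around
the origin. -/
theorem exists_sqrt_div {g : ℂ → ℂ} {r : ℝ} (hg : Continuous g) (hr0 : 0 ≤ r) (hr1 : r < 1)
    (hout : ∀ z, 1 ≤ ‖z‖ → g z = z) (hne : ∀ z ≠ 0, g z + r ≠ 0) :
    ∃ S : ℂ → ℂ, ContinuousOn S {0}ᶜ ∧ (∀ z ≠ 0, z * S z ^ 2 = g z + r) ∧
      ∀ z, ‖z‖ = 1 → S z = Complex.exp (Complex.log (1 + r * z⁻¹) / 2) := by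
  -- In the coordinate `z = exp ζ` the domain is simply connected.
  set q : ℂ → ℂ := fun ζ => (g (Complex.exp ζ) + r) / Complex.exp ζ with hq
  have hqc : Continuous q := by
    refine Continuous.div ?_ Complex.continuous_exp fun _ => Complex.exp_ne_zero _
    fun_prop
  obtain ⟨L₀, hL₀c, hL₀⟩ := exists_continuous_log hqc fun ζ =>
    div_ne_zero (hne _ (Complex.exp_ne_zero _)) (Complex.exp_ne_zero _)
  have hqout : ∀ ζ : ℂ, 0 ≤ ζ.re → q ζ = 1 + r * (Complex.exp ζ)⁻¹ := by
    intro ζ hζ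
    have : 1 ≤ ‖Complex.exp ζ‖ := by rw [Complex.norm_exp]; exact Real.one_le_exp hζ
    rw [hq]
    simp only [hout _ this]
    field_simp [Complex.exp_ne_zero ζ]
  have hslit : ∀ ζ : ℂ, 0 ≤ ζ.re → 1 + r * (Complex.exp ζ)⁻¹ ∈ Complex.slitPlane := by
    intro ζ hζ
    left
    have h1 : ‖(r : ℂ) * (Complex.exp ζ)⁻¹‖ ≤ r := by
      rw [← Complex.exp_neg, norm_mul, Complex.norm_exp, Complex.norm_real, Real.norm_of_nonneg hr0]
      refine mul_le_of_le_one_right hr0 (Real.exp_le_one_iff.2 ?_)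
      simpa using hζ
    have h2 := (abs_le.1 (Complex.abs_re_le_norm ((r : ℂ) * (Complex.exp ζ)⁻¹))).1
    rw [Complex.add_re, Complex.one_re]
    linarith
  set H : Set ℂ := {ζ | 0 ≤ ζ.re} with hH
  have hHconn : IsPreconnected H := (convex_halfSpace_re_ge 0).isPreconnected
  set d : ℂ → ℂ := fun ζ => L₀ ζ - Complex.log (1 + r * (Complex.exp ζ)⁻¹) with hd
  have hdc : ContinuousOn d H := by
    refine hL₀c.continuousOn.sub (ContinuousOn.clog ?_ fun ζ hζ => hslit ζ hζ)
    have : Continuous fun ζ => (Complex.exp ζ)⁻¹ :=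
      Complex.continuous_exp.inv₀ fun _ => Complex.exp_ne_zero _
    exact (continuous_const.add (continuous_const.mul this)).continuousOn
  have hd1 : ∀ ζ ∈ H, Complex.exp (d ζ) = 1 := by
    intro ζ hζ
    rw [hd]
    simp only [Complex.exp_sub, hL₀, hqout ζ hζ]
    rw [Complex.exp_log (Complex.slitPlane_ne_zero (hslit ζ hζ)),
      div_self (Complex.slitPlane_ne_zero (hslit ζ hζ))]
  have h0H : (0 : ℂ) ∈ H := by simp [hH]
  -- Normalize the logarithm to be the principal one over `1 ≤ |z|`.
  set L : ℂ → ℂ := fun ζ => L₀ ζ - d 0 with hL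
  have hLc : Continuous L := hL₀c.sub continuous_const
  have hLexp : ∀ ζ, Complex.exp (L ζ) = q ζ := fun ζ => by
    rw [hL]; simp only [Complex.exp_sub, hL₀, hd1 0 h0H, div_one]
  have hLout : ∀ ζ : ℂ, 0 ≤ ζ.re → L ζ = Complex.log (1 + r * (Complex.exp ζ)⁻¹) := by
    intro ζ hζ
    have := hHconn.exp_eq_one_const hdc hd1 (x := ζ) (y := 0) hζ h0H
    rw [hL]
    simp only [← this]
    rw [hd]
    ring
  -- The change of `L` over a period is constant, and it vanishes over `1 ≤ |z|`.
  have hper : ∀ ζ, L (ζ + 2 * Real.pi * Complex.I) = L ζ := by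
    intro ζ
    have h1 : ∀ ζ ∈ (univ : Set ℂ),
        Complex.exp (L (ζ + 2 * Real.pi * Complex.I) - L ζ) = 1 := by
      intro ζ _
      rw [Complex.exp_sub, hLexp, hLexp, hq]
      simp only [Complex.exp_periodic ζ]
      exact div_self (div_ne_zero (hne _ (Complex.exp_ne_zero _)) (Complex.exp_ne_zero _))
    have hc : Continuous fun ζ => L (ζ + 2 * Real.pi * Complex.I) - L ζ := by fun_prop
    have h2 := isPreconnected_univ.exp_eq_one_const hc.continuousOn h1 (mem_univ ζ) (mem_univ 0)
    have h3 : L (0 + 2 * Real.pi * Complex.I) - L 0 = 0 := by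
      rw [hLout _ (by simp), hLout 0 (by simp), Complex.exp_periodic 0, sub_self]
    simp only [h3] at h2
    exact sub_eq_zero.1 h2
  refine ⟨fun z => Complex.exp (L (Complex.log z) / 2), ?_, ?_, ?_⟩
  · intro z hz
    refine ContinuousAt.continuousWithinAt ?_
    by_cases hzs : z ∈ Complex.slitPlane
    · have := continuousAt_clog hzs
      fun_prop
    · have hz' : -z ∈ Complex.slitPlane := by
        rw [Complex.mem_slitPlane_iff] at hzs ⊢
        push Not at hzs
        left
        have : z.re ≠ 0 := fun h => hz (Complex.ext h hzs.2)
        rw [Complex.neg_re]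
        have := lt_of_le_of_ne hzs.1 this
        linarith
      -- Across the negative axis, `log z` and `log (-z) + π i` differ by a period of `L`.
      have heq : ∀ᶠ y in 𝓝 z, Complex.exp (L (Complex.log y) / 2) =
          Complex.exp (L (Complex.log (-y) + Real.pi * Complex.I) / 2) := by
        filter_upwards [isOpen_ne.mem_nhds hz] with y hy
        have h1 : Complex.exp (Complex.log y) =
            Complex.exp (Complex.log (-y) + Real.pi * Complex.I) := by
          rw [Complex.exp_add, Complex.exp_log hy, Complex.exp_log (neg_ne_zero.2 hy),
            Complex.exp_pi_mul_I]
          ring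
        obtain ⟨n, hn⟩ := Complex.exp_eq_exp_iff_exists_int.1 h1
        have hper' : Function.Periodic L (2 * Real.pi * Complex.I) := hper
        rw [hn, hper'.int_mul n]
      refine ContinuousAt.congr ?_ (heq.mono fun _ h => h.symm)
      have : ContinuousAt (fun y : ℂ => Complex.log (-y)) z :=
        ContinuousAt.clog continuousAt_neg hz'
      fun_prop
  · intro z hz
    have : Complex.exp (L (Complex.log z) / 2) ^ 2 = Complex.exp (L (Complex.log z)) := by
      rw [← Complex.exp_nat_mul]; congr 1; push_cast; ring
    simp only [this, hLexp]
    rw [hq]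
    simp only [Complex.exp_log hz]
    field_simp
  · intro z hz
    have hz0 : z ≠ 0 := by rintro rfl; simp at hz
    simp only
    rw [hLout _ (by simp [Complex.log_re, hz]), Complex.exp_log hz0]

/-! ### The area inequality -/

/-- The real-linear map of `ℂ` sending `1` to `a` and `I` to `b`. -/
noncomputable def partialsCLM (a b : ℂ) : ℂ →L[ℝ] ℂ :=
  Complex.reCLM.smulRight a + Complex.imCLM.smulRight b

theorem partialsCLM_apply (a b z : ℂ) : partialsCLM a b z = z.re * a + z.im * b := by
  simp [partialsCLM]

theorem det_partialsCLM (a b : ℂ) : (partialsCLM a b).det = (conj a * b).im := by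
  rw [ContinuousLinearMap.det, ← LinearMap.det_toMatrix Complex.basisOneI, Matrix.det_fin_two]
  simp [LinearMap.toMatrix_apply, partialsCLM]
  ring

theorem normSq_dz_sub_normSq_dzbar (f : ℂ → ℂ) (z : ℂ) :
    ‖dz f z‖ ^ 2 - ‖dzbar f z‖ ^ 2 =
      (conj (lineDeriv ℝ f z 1) * lineDeriv ℝ f z Complex.I).im := by
  rw [dz, dzbar, ← Complex.normSq_eq_norm_sq, ← Complex.normSq_eq_norm_sq]
  simp [Complex.normSq_apply]
  ring

theorem measurable_dq_set {f f' : ℂ → ℂ} {v : ℂ} (hf : Continuous f) (hf' : Measurable f')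
    (ε δ : ℝ) :
    MeasurableSet {z | ∀ h : ℚ, |(h : ℝ)| < δ →
      ‖f (z + (h : ℝ) • v) - f z - (h : ℝ) • f' z‖ ≤ ε * |(h : ℝ)|} := by
  have : {z | ∀ h : ℚ, |(h : ℝ)| < δ →
      ‖f (z + (h : ℝ) • v) - f z - (h : ℝ) • f' z‖ ≤ ε * |(h : ℝ)|} =
      ⋂ h : ℚ, ⋂ _ : |(h : ℝ)| < δ,
        {z | ‖f (z + (h : ℝ) • v) - f z - (h : ℝ) • f' z‖ ≤ ε * |(h : ℝ)|} := by
    ext; simp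
  rw [this]
  refine MeasurableSet.iInter fun h => MeasurableSet.iInter fun _ => ?_
  refine measurableSet_le (Measurable.norm ?_) measurable_const
  have h1 : Measurable fun z => f (z + (h : ℝ) • v) :=
    (hf.comp (continuous_id.add continuous_const)).measurable
  exact (h1.sub hf.measurable).sub (hf'.const_smul (h : ℝ))

/-- An Egorov theorem for the difference quotients in a fixed direction: off a set of small
measure they converge uniformly to the directional derivative. -/
theorem exists_uniform_lineDeriv {f : ℂ → ℂ} {v : ℂ} {D : Set ℂ} (hf : Continuous f)
    (hD : MeasurableSet D) (hfin : volume D ≠ ∞)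
    (hd : ∀ᵐ z ∂volume.restrict D, LineDifferentiableAt ℝ f z v) {η : ℝ≥0∞} (hη : η ≠ 0) :
    ∃ E ⊆ D, MeasurableSet E ∧ volume (D \ E) ≤ η ∧ ∀ ε > 0, ∃ δ > 0, ∀ z ∈ E, ∀ h : ℝ, |h| < δ →
      ‖f (z + h • v) - f z - h • lineDeriv ℝ f z v‖ ≤ ε * |h| := by
  set A : ℕ → ℕ → Set ℂ := fun k n => {z | ∀ h : ℚ, |(h : ℝ)| < 1 / (n + 1 : ℝ) →
      ‖f (z + (h : ℝ) • v) - f z - (h : ℝ) • lineDeriv ℝ f z v‖ ≤ 1 / (k + 1 : ℝ) * |(h : ℝ)|} with hA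
  have hAm : ∀ k n, MeasurableSet (A k n) := fun k n =>
    measurable_dq_set hf (measurable_lineDeriv hf) _ _
  obtain ⟨ν, hν0, hνsum⟩ := ENNReal.exists_pos_sum_of_countable' hη ℕ
  have hlim : ∀ k, ∃ n, volume (D \ A k n) < ν k := by
    intro k
    have hanti : Antitone fun n => D \ A k n := by
      intro n m hnm
      refine sdiff_subset_sdiff_right fun z hz h hh => hz h (hh.trans_le ?_)
      exact one_div_le_one_div_of_le (by positivity) (by exact_mod_cast Nat.succ_le_succ hnm)
    have hzero : volume (⋂ n, D \ A k n) = 0 := by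
      rw [ae_restrict_iff' hD] at hd
      refine measure_mono_null ?_ hd
      intro z hz hzd
      rw [mem_iInter] at hz
      have hzd' := hzd (hz 0).1
      have hder := hzd'.hasLineDerivAt
      have hlo := (hasDerivAt_iff_isLittleO.1 hder).def (c := 1 / (k + 1 : ℝ)) (by positivity)
      rw [Metric.eventually_nhds_iff] at hlo
      obtain ⟨δ, hδ, hlo⟩ := hlo
      obtain ⟨n, hn⟩ := exists_nat_one_div_lt hδ
      refine (hz n).2 fun h hh => ?_
      have := @hlo (h : ℝ) (by rw [Real.dist_eq, sub_zero]; exact hh.trans hn)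
      simpa only [zero_add, zero_smul, add_zero, sub_zero, Real.norm_eq_abs] using this
    have ht := tendsto_measure_iInter_atTop (μ := volume)
      (fun n => (hD.diff (hAm k n)).nullMeasurableSet) hanti
      ⟨0, measure_ne_top_of_subset sdiff_subset hfin⟩
    rw [hzero] at ht
    exact ((tendsto_order.1 ht).2 _ (hν0 k)).exists
  choose n hn using hlim
  refine ⟨D ∩ ⋂ k, A k (n k), inter_subset_left, hD.inter (MeasurableSet.iInter fun k => hAm k _),
    ?_, ?_⟩
  · have : D \ (D ∩ ⋂ k, A k (n k)) = ⋃ k, D \ A k (n k) := by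
      rw [sdiff_self_inter, sdiff_iInter]
    rw [this]
    exact (measure_iUnion_le _).trans ((ENNReal.tsum_le_tsum fun k => (hn k).le).trans hνsum.le)
  · intro ε hε
    obtain ⟨k, hk⟩ := exists_nat_one_div_lt hε
    refine ⟨1 / (n k + 1 : ℝ), by positivity, fun z hz h hh => ?_⟩
    have hzA := mem_iInter.1 hz.2 k
    -- The estimate passes from rational to real increments by continuity.
    have hclosed : IsClosed {h : ℝ | ‖f (z + h • v) - f z - h • lineDeriv ℝ f z v‖ ≤ ε * |h|} :=
      isClosed_le (by fun_prop) (by fun_prop)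
    have hopen : IsOpen {h : ℝ | |h| < 1 / (n k + 1 : ℝ)} := isOpen_lt (by fun_prop) (by fun_prop)
    have hdense := Rat.isDenseEmbedding_coe_real.dense.open_subset_closure_inter hopen
    refine hclosed.closure_subset_iff.2 ?_ (hdense hh)
    rintro _ ⟨hq, q, rfl⟩
    exact (hzA q hq).trans (by gcongr)

/-- A continuous map with uniform difference quotients in the direction `I` along `E` is
differentiable relative to `E`: go first along the direction `1` from the base point, then along
the direction `I` back from the second point, which is also in `E`. -/
theorem hasFDerivWithinAt_of_uniform {f : ℂ → ℂ} {E : Set ℂ} (hf : Continuous f)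
    (hu : ∀ ε > 0, ∃ δ > 0, ∀ z ∈ E, ∀ h : ℝ, |h| < δ →
      ‖f (z + h • Complex.I) - f z - h • lineDeriv ℝ f z Complex.I‖ ≤ ε * |h|)
    {z : ℂ} (hz : z ∈ E) (hx : LineDifferentiableAt ℝ f z 1) :
    HasFDerivWithinAt f (partialsCLM (lineDeriv ℝ f z 1) (lineDeriv ℝ f z Complex.I)) E z := by
  set fy := fun z => lineDeriv ℝ f z Complex.I with hfy
  -- The derivative in the direction `I` is a uniform limit of continuous functions on `E`.
  have hcont : ContinuousOn fy E := by
    have hunif : TendstoUniformlyOn (fun (h : ℝ) z => h⁻¹ • (f (z + h • Complex.I) - f z)) fy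
        (𝓝[≠] 0) E := by
      rw [Metric.tendstoUniformlyOn_iff]
      intro ε hε
      obtain ⟨δ, hδ, H⟩ := hu (ε / 2) (by positivity)
      have : ∀ᶠ h : ℝ in 𝓝[≠] 0, |h| < δ := by
        refine Filter.Eventually.filter_mono nhdsWithin_le_nhds ?_
        exact (isOpen_lt continuous_abs continuous_const).mem_nhds (by simpa using hδ)
      filter_upwards [this, self_mem_nhdsWithin] with h hh hh0 w hw
      have h0 : h ≠ 0 := hh0
      have := H w hw h hh
      rw [dist_eq_norm, norm_sub_rev]
      have e : h⁻¹ • (f (w + h • Complex.I) - f w) - fy w =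
          h⁻¹ • (f (w + h • Complex.I) - f w - h • fy w) := by
        rw [smul_sub h⁻¹ (_ - _), smul_smul, inv_mul_cancel₀ h0, one_smul]
      rw [e, norm_smul, norm_inv, Real.norm_eq_abs, inv_mul_lt_iff₀ (abs_pos.2 h0)]
      nlinarith [abs_pos.2 h0]
    refine hunif.continuousOn (Filter.Frequently.of_forall fun h => ?_)
    fun_prop
  rw [hasFDerivWithinAt_iff_isLittleO, Asymptotics.isLittleO_iff]
  intro c hc
  obtain ⟨δ₁, hδ₁, H₁⟩ := hu (c / 3) (by positivity)
  have hlo := (hasDerivAt_iff_isLittleO.1 hx.hasLineDerivAt).def (c := c / 3) (by positivity)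
  rw [Metric.eventually_nhds_iff] at hlo
  obtain ⟨δ₂, hδ₂, H₂⟩ := hlo
  obtain ⟨δ₃, hδ₃, H₃⟩ := Metric.continuousWithinAt_iff.1 (hcont z hz) (c / 3) (by positivity)
  have hball : Metric.ball z (min δ₁ (min δ₂ δ₃)) ∈ 𝓝[E] z :=
    mem_nhdsWithin_of_mem_nhds (Metric.ball_mem_nhds _ (by positivity))
  filter_upwards [hball, self_mem_nhdsWithin] with w hw hwE
  rw [Metric.mem_ball, lt_min_iff, lt_min_iff, dist_eq_norm] at hw
  obtain ⟨hw1, hw2, hw3⟩ := hw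
  have hre := Complex.abs_re_le_norm (w - z)
  have him := Complex.abs_im_le_norm (w - z)
  set a := (w - z).re with ha
  set b := (w - z).im with hb
  have hdec : w = z + a • (1 : ℂ) + b • Complex.I := by
    have := Complex.re_add_im (w - z)
    rw [← ha, ← hb] at this
    simp only [Complex.real_smul, mul_one]
    linear_combination -this
  have e1 : ‖f (z + a • (1 : ℂ)) - f z - a • lineDeriv ℝ f z 1‖ ≤ c / 3 * |a| := by
    have := @H₂ a (by simpa using hre.trans_lt hw2)
    simpa using this
  have e2 : ‖f (z + a • (1 : ℂ)) - f w + b • fy w‖ ≤ c / 3 * |b| := by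
    have := H₁ w hwE (-b) (by rw [abs_neg]; exact him.trans_lt hw1)
    have h1 : w + (-b) • Complex.I = z + a • (1 : ℂ) := by
      rw [hdec]; simp
    rw [h1, abs_neg, neg_smul, sub_neg_eq_add] at this
    exact this
  have e3 : ‖fy w - fy z‖ ≤ c / 3 := by
    rw [← dist_eq_norm]
    exact (H₃ hwE (by rw [dist_eq_norm]; exact hw3)).le
  have hid : f w - f z - partialsCLM (lineDeriv ℝ f z 1) (lineDeriv ℝ f z Complex.I) (w - z) =
      (f (z + a • (1 : ℂ)) - f z - a • lineDeriv ℝ f z 1) -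
      (f (z + a • (1 : ℂ)) - f w + b • fy w) + b • (fy w - fy z) := by
    rw [partialsCLM_apply]
    simp only [Complex.real_smul, hfy, ← ha, ← hb]
    ring
  rw [hid]
  calc _ ≤ ‖f (z + a • (1 : ℂ)) - f z - a • lineDeriv ℝ f z 1‖ +
        ‖f (z + a • (1 : ℂ)) - f w + b • fy w‖ + ‖b • (fy w - fy z)‖ :=
        (norm_add_le _ _).trans (by gcongr; exact norm_sub_le _ _)
    _ ≤ c / 3 * |a| + c / 3 * |b| + |b| * (c / 3) := by
        rw [norm_smul, Real.norm_eq_abs]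
        gcongr
    _ ≤ c / 3 * ‖w - z‖ + c / 3 * ‖w - z‖ + ‖w - z‖ * (c / 3) := by gcongr
    _ = c * ‖w - z‖ := by ring

/-- The area inequality for an injective continuous map that has partial derivatives almost
everywhere. The map need not satisfy Lusin's condition, hence only an inequality. -/
theorem lintegral_jacobian_mul_le {f : ℂ → ℂ} {D : Set ℂ} (hf : Continuous f)
    (hD : MeasurableSet D) (hfin : volume D ≠ ∞) (hinj : InjOn f D)
    (hx : ∀ᵐ z ∂volume.restrict D, LineDifferentiableAt ℝ f z 1)
    (hy : ∀ᵐ z ∂volume.restrict D, LineDifferentiableAt ℝ f z Complex.I) (φ : ℂ → ℝ≥0∞) :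
    ∫⁻ z in D, ENNReal.ofReal (‖dz f z‖ ^ 2 - ‖dzbar f z‖ ^ 2) * φ (f z) ≤
      ∫⁻ z in f '' D, φ z := by
  choose E hED hEm hEsmall hEu using fun n : ℕ =>
    exists_uniform_lineDeriv hf hD hfin hy (η := (n + 1 : ℝ≥0∞)⁻¹)
      (ENNReal.inv_ne_zero.2 (by finiteness))
  set X := {z | LineDifferentiableAt ℝ f z 1} with hX
  have hXm : MeasurableSet X := measurableSet_lineDifferentiableAt hf
  -- Relative differentiability holds on each piece separately, not on their union.
  set F : ℕ → Set ℂ := disjointed fun n => E n ∩ X with hF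
  have hFsub : ∀ n, F n ⊆ E n ∩ X := fun n => disjointed_subset _ n
  have hFm : ∀ n, MeasurableSet (F n) :=
    MeasurableSet.disjointed fun n => (hEm n).inter hXm
  have hFdisj : Pairwise (Function.onFun Disjoint F) := disjoint_disjointed _
  have hFD : ∀ n, F n ⊆ D := fun n => (hFsub n).trans (inter_subset_left.trans (hED n))
  have hUnion : (⋃ n, F n) =ᵐ[volume] D := by
    rw [iUnion_disjointed, ← iUnion_inter]
    refine Filter.EventuallyLE.antisymm
      (LE.le.eventuallyLE (inter_subset_left.trans (iUnion_subset hED))) ?_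
    rw [ae_le_set]
    refine measure_mono_null (t := (D \ ⋃ n, E n) ∪ (D \ X)) ?_ (measure_union_null ?_ ?_)
    · intro z hz
      by_cases h : z ∈ ⋃ n, E n
      · exact Or.inr ⟨hz.1, fun h' => hz.2 ⟨h, h'⟩⟩
      · exact Or.inl ⟨hz.1, h⟩
    · have hle : ∀ n : ℕ, volume (D \ ⋃ n, E n) ≤ (n + 1 : ℝ≥0∞)⁻¹ := fun n =>
        (measure_mono (sdiff_subset_sdiff_right (subset_iUnion E n))).trans (hEsmall n)
      refine le_antisymm (ge_of_tendsto' (f := fun n : ℕ => ((n + 1 : ℕ) : ℝ≥0∞)⁻¹) (x := Filter.atTop) ?_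
        fun n => by simpa using hle n) zero_le
      exact ENNReal.tendsto_inv_nat_nhds_zero.comp (Filter.tendsto_add_atTop_nat 1)
    · rw [ae_restrict_iff' hD] at hx
      refine measure_mono_null ?_ hx
      exact fun z hz h => hz.2 (h hz.1)
  have hpiece : ∀ n, ∫⁻ z in F n, ENNReal.ofReal (‖dz f z‖ ^ 2 - ‖dzbar f z‖ ^ 2) * φ (f z) ≤
      ∫⁻ z in f '' F n, φ z := by
    intro n
    rw [lintegral_image_eq_lintegral_abs_det_fderiv_mul volume (hFm n)
      (fun z hz => (hasFDerivWithinAt_of_uniform hf (hEu n) (hFsub n hz).1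
        (hFsub n hz).2).mono ((hFsub n).trans inter_subset_left)) (hinj.mono (hFD n)) φ]
    refine lintegral_mono fun z => ?_
    dsimp only
    rw [det_partialsCLM, ← normSq_dz_sub_normSq_dzbar]
    gcongr
    exact le_abs_self _
  have himm : ∀ n, MeasurableSet (f '' F n) := fun n =>
    (hFm n).image_of_continuousOn_injOn hf.continuousOn (hinj.mono (hFD n))
  have himdisj : Pairwise (Function.onFun Disjoint fun n => f '' F n) := by
    intro i j hij
    exact (hFdisj hij).image hinj (hFD i) (hFD j)
  rw [← setLIntegral_congr hUnion, lintegral_iUnion hFm hFdisj]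
  refine (ENNReal.tsum_le_tsum hpiece).trans ?_
  rw [← lintegral_iUnion himm himdisj, ← image_iUnion]
  exact lintegral_mono_set (image_mono (iUnion_subset hFD))

/-! ### Integrals of powers of the modulus over discs -/

theorem lintegral_norm_rpow_ball {s : ℝ} (hs : -2 < s) :
    ∫⁻ z in Metric.ball (0 : ℂ) 1, ENNReal.ofReal (‖z‖ ^ s) =
      ENNReal.ofReal (2 * Real.pi / (s + 2)) := by
  have hset : ∀ p ∈ Complex.polarCoord.target,
      ENNReal.ofReal p.1 • (Metric.ball (0 : ℂ) 1).indicator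
        (fun z => ENNReal.ofReal (‖z‖ ^ s)) (Complex.polarCoord.symm p) =
      (Ioo (0 : ℝ) 1 ×ˢ Ioo (-Real.pi) Real.pi).indicator
        (fun p => ENNReal.ofReal (p.1 ^ (s + 1))) p := by
    rintro ⟨ρ, θ⟩ hp
    rw [Complex.polarCoord_target] at hp
    have hρ : 0 < ρ := hp.1
    have hn : ‖Complex.polarCoord.symm (ρ, θ)‖ = ρ := by
      rw [Complex.norm_polarCoord_symm, abs_of_pos hρ]
    by_cases h1 : ρ < 1
    · rw [indicator_of_mem (by rw [mem_ball_zero_iff, hn]; exact h1),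
        indicator_of_mem (show (ρ, θ) ∈ Ioo (0 : ℝ) 1 ×ˢ Ioo (-Real.pi) Real.pi from
          ⟨⟨hρ, h1⟩, hp.2⟩), hn,
        smul_eq_mul, ← ENNReal.ofReal_mul hρ.le, Real.rpow_add hρ, Real.rpow_one, mul_comm]
    · rw [indicator_of_notMem (by rw [mem_ball_zero_iff, hn]; exact h1),
        indicator_of_notMem (fun h => h1 h.1.2),
        smul_zero]
  rw [← lintegral_indicator Metric.isOpen_ball.measurableSet,
    ← Complex.lintegral_comp_polarCoord_symm,
    show polarCoord.target = Complex.polarCoord.target from rfl,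
    setLIntegral_congr_fun Complex.polarCoord.open_target.measurableSet hset,
    lintegral_indicator (measurableSet_Ioo.prod measurableSet_Ioo),
    Measure.restrict_restrict (measurableSet_Ioo.prod measurableSet_Ioo)]
  have hinter : Ioo (0 : ℝ) 1 ×ˢ Ioo (-Real.pi) Real.pi ∩ Complex.polarCoord.target =
      Ioo (0 : ℝ) 1 ×ˢ Ioo (-Real.pi) Real.pi :=
    inter_eq_left.2 (prod_mono (fun x hx => hx.1) subset_rfl)
  rw [hinter, Measure.volume_eq_prod, ← Measure.prod_restrict, lintegral_prod _ (by fun_prop)]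
  simp only [lintegral_const, Measure.restrict_apply_univ, Real.volume_Ioo]
  rw [lintegral_mul_const' _ _ ENNReal.ofReal_ne_top]
  have hint : IntegrableOn (fun x : ℝ => x ^ (s + 1)) (Ioo 0 1) := by
    have := intervalIntegral.intervalIntegrable_rpow' (a := 0) (b := 1) (r := s + 1) (by linarith)
    rw [intervalIntegrable_iff_integrableOn_Ioo_of_le zero_le_one] at this
    exact this
  rw [← ofReal_integral_eq_lintegral_ofReal hint ?_, ← ENNReal.ofReal_mul', ← integral_Ioc_eq_integral_Ioo,
    ← intervalIntegral.integral_of_le zero_le_one, integral_rpow (Or.inl (by linarith))]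
  · congr 1
    rw [Real.one_rpow, Real.zero_rpow (by linarith)]
    field_simp
    ring
  · linarith [Real.pi_pos]
  · refine (ae_restrict_iff' measurableSet_Ioo).2 (Filter.Eventually.of_forall fun x hx => ?_)
    exact Real.rpow_nonneg hx.1.le _

/-- Among the translates of the unit disc, the centred one maximizes the integral of `1 / |z|`. -/
theorem lintegral_inv_norm_add_ball_le (w : ℂ) :
    ∫⁻ z in Metric.ball (0 : ℂ) 1, ENNReal.ofReal ‖z + w‖⁻¹ ≤ ENNReal.ofReal (2 * Real.pi) := by
  set φ : ℂ → ℝ≥0∞ := fun z => ENNReal.ofReal ‖z‖⁻¹ with hφ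
  set A := Metric.ball (0 : ℂ) 1 with hA
  set B := Metric.ball w 1 with hB
  have hAm : MeasurableSet A := measurableSet_ball
  have hBm : MeasurableSet B := measurableSet_ball
  have htrans : ∫⁻ z in A, φ (z + w) = ∫⁻ z in B, φ z := by
    rw [← lintegral_indicator hAm, ← lintegral_indicator hBm,
      ← lintegral_add_right_eq_self (B.indicator φ) w]
    congr 1
    funext z
    simp only [indicator, hA, hB, Metric.mem_ball, dist_eq_norm, add_sub_cancel_right, sub_zero]
  have hvol : volume (B \ A) = volume (A \ B) := by
    have h1 := measure_inter_add_sdiff (μ := volume) B hAm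
    have h2 := measure_inter_add_sdiff (μ := volume) A hBm
    have h3 : volume B = volume A := by rw [hA, hB, Complex.volume_ball, Complex.volume_ball]
    rw [h3, ← h2, inter_comm] at h1
    exact (ENNReal.add_right_inj
      (measure_ne_top_of_subset inter_subset_left measure_ball_lt_top.ne)).1 h1
  have hball : ∫⁻ z in A, φ z = ENNReal.ofReal (2 * Real.pi) := by
    have := lintegral_norm_rpow_ball (s := -1) (by norm_num)
    simp only [Real.rpow_neg_one] at this
    rw [hφ, hA, this]
    norm_num
  calc ∫⁻ z in A, φ (z + w) = ∫⁻ z in B, φ z := htrans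
    _ = (∫⁻ z in B ∩ A, φ z) + ∫⁻ z in B \ A, φ z := (lintegral_inter_add_sdiff _ _ hAm).symm
    _ ≤ (∫⁻ z in B ∩ A, φ z) + volume (B \ A) := by
        gcongr
        rw [← setLIntegral_one]
        refine setLIntegral_mono measurable_const fun z hz => ?_
        have : 1 ≤ ‖z‖ := by simpa [hA] using hz.2
        exact ENNReal.ofReal_le_one.2 (inv_le_one_of_one_le₀ this)
    _ = (∫⁻ z in A ∩ B, φ z) + volume (A \ B) := by rw [hvol, inter_comm]
    _ ≤ (∫⁻ z in A ∩ B, φ z) + ∫⁻ z in A \ B, φ z := by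
        gcongr
        rw [← setLIntegral_one]
        refine setLIntegral_mono_ae (by fun_prop) ?_
        have h0 : ∀ᵐ z : ℂ, z ≠ 0 := by simp [ae_iff]
        filter_upwards [h0] with z h0 hz
        have : ‖z‖ < 1 := by simpa [hA] using hz.1
        exact ENNReal.one_le_ofReal.2 (one_le_inv_iff₀.2 ⟨norm_pos_iff.2 h0, this.le⟩)
    _ = ∫⁻ z in A, φ z := lintegral_inter_add_sdiff _ _ hBm
    _ = _ := hball

/-! ### Integration along chords of the disc -/

/-- The pair `(v', v)` is `(I, 1)` or `(1, I)`. This treats both families of lines parallel to the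
axes at once: `v` is the direction of the lines and `s * v'` runs through their base points. -/
def IsAxisPair (v' v : ℂ) : Prop := (v' = Complex.I ∧ v = 1) ∨ (v' = 1 ∧ v = Complex.I)

namespace IsAxisPair

variable {v' v : ℂ}

theorem norm_sq (h : IsAxisPair v' v) (s t : ℝ) : ‖(s : ℂ) * v' + t * v‖ ^ 2 = s ^ 2 + t ^ 2 := by
  rw [← Complex.normSq_eq_norm_sq, Complex.normSq_apply]
  rcases h with ⟨rfl, rfl⟩ | ⟨rfl, rfl⟩ <;> simp <;> ring

theorem measurePreserving (h : IsAxisPair v' v) :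
    MeasurePreserving (fun p : ℝ × ℝ => (p.1 : ℂ) * v' + p.2 * v) := by
  have h0 := Complex.volume_preserving_equiv_real_prod.symm
  rcases h with ⟨rfl, rfl⟩ | ⟨rfl, rfl⟩
  · have h1 := h0.comp (Measure.measurePreserving_swap (μ := (volume : Measure ℝ))
      (ν := (volume : Measure ℝ)))
    have e : (fun p : ℝ × ℝ => (p.1 : ℂ) * Complex.I + p.2 * 1) =
        Complex.measurableEquivRealProd.symm ∘ Prod.swap := by
      funext p
      apply Complex.ext <;> simp [Complex.measurableEquivRealProd]
    rw [e]
    exact h1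
  · convert h0 using 1
    funext p
    apply Complex.ext <;> simp [Complex.measurableEquivRealProd]

theorem measurableEmbedding (h : IsAxisPair v' v) :
    MeasurableEmbedding (fun p : ℝ × ℝ => (p.1 : ℂ) * v' + p.2 * v) := by
  refine Continuous.measurableEmbedding (by fun_prop) fun p q hpq => ?_
  have h1 : ((p.1 - q.1 : ℝ) : ℂ) * v' + ((p.2 - q.2 : ℝ) : ℂ) * v = 0 := by
    push_cast
    linear_combination hpq
  have h2 := h.norm_sq (p.1 - q.1) (p.2 - q.2)
  rw [h1, norm_zero] at h2
  have h3 : p.1 - q.1 = 0 := by nlinarith [sq_nonneg (p.1 - q.1), sq_nonneg (p.2 - q.2)]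
  have h4 : p.2 - q.2 = 0 := by nlinarith [sq_nonneg (p.1 - q.1), sq_nonneg (p.2 - q.2)]
  exact Prod.ext (sub_eq_zero.1 h3) (sub_eq_zero.1 h4)

theorem mem_ball (h : IsAxisPair v' v) (s t : ℝ) :
    (s : ℂ) * v' + t * v ∈ Metric.ball (0 : ℂ) 1 ↔ s ^ 2 + t ^ 2 < 1 := by
  rw [mem_ball_zero_iff, ← h.norm_sq, sq_lt_one_iff₀ (norm_nonneg _)]

theorem ne_zero (h : IsAxisPair v' v) {s : ℝ} (hs : s ≠ 0) (t : ℝ) : (s : ℂ) * v' + t * v ≠ 0 := by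
  intro h0
  have := h.norm_sq s t
  rw [h0, norm_zero] at this
  have : 0 < s ^ 2 := by positivity
  nlinarith [sq_nonneg t]

end IsAxisPair

/-- Almost every axis-parallel line has a chord in the disc on all of whose compact centred
subsegments `f` is absolutely continuous: countably many rectangles suffice. -/
theorem ACL.ae_chord {f : ℂ → ℂ} (hf : ACL f (Metric.ball 0 1)) {v' v : ℂ}
    (h : IsAxisPair v' v) :
    ∀ᵐ s : ℝ, ∀ m : ℝ, m ^ 2 + s ^ 2 < 1 →
      AbsolutelyContinuousOnInterval (fun t : ℝ => f (s * v' + t * v)) (-m) m := by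
  have hrect : ∀ q d : ℝ, q ^ 2 + d ^ 2 < 1 →
      Icc (-q) q ×ℂ Icc (-d) d ⊆ Metric.ball (0 : ℂ) 1 := by
    intro q d hqd z hz
    rw [Complex.mem_reProdIm] at hz
    have h1 := sq_le_sq' hz.1.1 hz.1.2
    have h2 := sq_le_sq' hz.2.1 hz.2.2
    rw [mem_ball_zero_iff, ← sq_lt_one_iff₀ (norm_nonneg _), ← Complex.normSq_eq_norm_sq,
      Complex.normSq_apply]
    nlinarith
  have hae : ∀ᵐ s : ℝ, ∀ q d : ℚ, 0 < (q : ℝ) → 0 < (d : ℝ) → (q : ℝ) ^ 2 + (d : ℝ) ^ 2 < 1 →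
      s ∈ Icc (-(d : ℝ)) d →
      AbsolutelyContinuousOnInterval (fun t : ℝ => f (s * v' + t * v)) (-(q : ℝ)) q := by
    simp only [ae_all_iff]
    intro q d hq hd hqd
    rcases h with ⟨rfl, rfl⟩ | ⟨rfl, rfl⟩
    · filter_upwards [(hf (-q) q (-d) d (by linarith) (by linarith) (hrect q d hqd)).1] with s hs h
      simpa [add_comm] using hs h
    · rw [add_comm] at hqd
      filter_upwards [(hf (-d) d (-q) q (by linarith) (by linarith) (hrect d q hqd)).2] with s hs h
      simpa using hs h
  filter_upwards [hae] with s hs m hm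
  have h1 : |m| < √(1 - s ^ 2) := by
    rw [← Real.sqrt_sq_eq_abs]
    exact Real.sqrt_lt_sqrt (sq_nonneg _) (by linarith)
  obtain ⟨q, hq1, hq2⟩ := exists_rat_btwn h1
  have hq0 : 0 < (q : ℝ) := (abs_nonneg m).trans_lt hq1
  have hq3 : (q : ℝ) ^ 2 < 1 - s ^ 2 := (Real.lt_sqrt hq0.le).1 hq2
  have h2 : |s| < √(1 - (q : ℝ) ^ 2) := by
    rw [← Real.sqrt_sq_eq_abs]
    exact Real.sqrt_lt_sqrt (sq_nonneg _) (by linarith)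
  obtain ⟨d, hd1, hd2⟩ := exists_rat_btwn h2
  have hd0 : 0 < (d : ℝ) := (abs_nonneg s).trans_lt hd1
  have hd3 : (d : ℝ) ^ 2 < 1 - (q : ℝ) ^ 2 := (Real.lt_sqrt hd0.le).1 hd2
  refine (hs q d hq0 hd0 (by linarith) (abs_le.1 hd1.le)).mono ?_
  have hm' := abs_le.1 hq1.le
  refine uIcc_subset_uIcc ?_ ?_ <;> rw [uIcc_of_le (by linarith)] <;> constructor <;> linarith

theorem ACL.ae_lineDifferentiableAt {f : ℂ → ℂ} (hf : ACL f (Metric.ball 0 1))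
    (hc : Continuous f) {v' v : ℂ} (h : IsAxisPair v' v) :
    ∀ᵐ z ∂volume.restrict (Metric.ball (0 : ℂ) 1), LineDifferentiableAt ℝ f z v := by
  rw [ae_restrict_iff' measurableSet_ball]
  have hmeas : MeasurableSet {z : ℂ | z ∈ Metric.ball (0 : ℂ) 1 → LineDifferentiableAt ℝ f z v} := by
    have : {z : ℂ | z ∈ Metric.ball (0 : ℂ) 1 → LineDifferentiableAt ℝ f z v} =
        (Metric.ball (0 : ℂ) 1)ᶜ ∪ {z | LineDifferentiableAt ℝ f z v} := by
      ext z; simp only [mem_ofPred_eq, mem_union, mem_compl_iff]; tauto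
    rw [this]
    exact measurableSet_ball.compl.union (measurableSet_lineDifferentiableAt hc)
  rw [← h.measurePreserving.map_eq, ae_map_iff h.measurePreserving.aemeasurable hmeas,
    Measure.volume_eq_prod, Measure.ae_prod_iff_ae_ae
      (p := fun p : ℝ × ℝ => (p.1 : ℂ) * v' + p.2 * v ∈ Metric.ball (0 : ℂ) 1 →
        LineDifferentiableAt ℝ f ((p.1 : ℂ) * v' + p.2 * v) v)
      (h.measurePreserving.measurable hmeas)]
  filter_upwards [hf.ae_chord h] with s hs
  have hall : ∀ᵐ t : ℝ, ∀ q : ℚ, (q : ℝ) ^ 2 + s ^ 2 < 1 → t ∈ uIcc (-(q : ℝ)) q →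
      DifferentiableAt ℝ (fun t : ℝ => f (s * v' + t * v)) t := by
    simp only [ae_all_iff]
    exact fun q hq => (hs q hq).ae_differentiableAt_complex
  filter_upwards [hall] with t ht hmem
  rw [h.mem_ball] at hmem
  have h1 : |t| < √(1 - s ^ 2) := by
    rw [← Real.sqrt_sq_eq_abs]
    exact Real.sqrt_lt_sqrt (sq_nonneg _) (by linarith)
  obtain ⟨q, hq1, hq2⟩ := exists_rat_btwn h1
  have hq0 : 0 < (q : ℝ) := (abs_nonneg t).trans_lt hq1
  have hq3 : (q : ℝ) ^ 2 < 1 - s ^ 2 := (Real.lt_sqrt hq0.le).1 hq2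
  refine lineDifferentiableAt_line (ht q (by linarith) ?_)
  rw [uIcc_of_le (by linarith)]
  exact abs_le.1 hq1.le

/-- The fundamental theorem of calculus extends from compact centred subintervals to the whole
interval by continuity. -/
theorem intervalIntegral_eq_sub_of_forall_lt {φ R : ℝ → ℂ} {m₀ : ℝ} (hm₀ : 0 < m₀)
    (hφ : IntervalIntegrable φ volume (-m₀) m₀) (hR : ContinuousOn R (Icc (-m₀) m₀))
    (h : ∀ m ∈ Ioo 0 m₀, ∫ t in (-m)..m, φ t = R m - R (-m)) :
    ∫ t in (-m₀)..m₀, φ t = R m₀ - R (-m₀) := by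
  have hle : -m₀ ≤ m₀ := by linarith
  have hprim : ContinuousOn (fun x => ∫ t in (-m₀)..x, φ t) (Icc (-m₀) m₀) := by
    have := intervalIntegral.continuousOn_primitive_interval (μ := volume) (f := φ)
      (a := -m₀) (b := m₀)
      (by rw [uIcc_of_le hle]; exact (intervalIntegrable_iff_integrableOn_Icc_of_le hle).1 hφ)
    rwa [uIcc_of_le hle] at this
  have hneg : MapsTo (fun m : ℝ => -m) (Icc 0 m₀) (Icc (-m₀) m₀) := fun m hm =>
    ⟨by linarith [hm.2], by linarith [hm.1]⟩
  have hpos : Icc 0 m₀ ⊆ Icc (-m₀) m₀ := Icc_subset_Icc_left (by linarith)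
  set L : ℝ → ℂ := fun m => (∫ t in (-m₀)..m, φ t) - ∫ t in (-m₀)..(-m), φ t with hL
  have hLc : ContinuousOn L (Icc 0 m₀) :=
    (hprim.mono hpos).sub (hprim.comp continuousOn_neg hneg)
  have hRc : ContinuousOn (fun m => R m - R (-m)) (Icc 0 m₀) :=
    (hR.mono hpos).sub (hR.comp continuousOn_neg hneg)
  have heq : EqOn L (fun m => R m - R (-m)) (Ioo 0 m₀) := by
    intro m hm
    have hsub : ∀ x ∈ Icc (-m₀) m₀, IntervalIntegrable φ volume (-m₀) x := fun x hx =>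
      hφ.mono_set (by
        rw [uIcc_of_le hx.1, uIcc_of_le hle]
        exact Icc_subset_Icc_right hx.2)
    rw [hL]
    simp only
    rw [intervalIntegral.integral_interval_sub_left (hsub _ (hpos ⟨hm.1.le, hm.2.le⟩))
      (hsub _ (hneg ⟨hm.1.le, hm.2.le⟩)), h m hm]
  have hfin := heq.of_subset_closure hLc hRc Ioo_subset_Icc_self
    (by rw [closure_Ioo hm₀.ne]) (right_mem_Icc.2 hm₀.le)
  simpa [hL] using hfin

/-- Integrating the directional derivative of `S z * (α + β * z / |z|)` over the unit disc chord by
chord. Only the chords through the origin, where this function is singular, are exceptional. -/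
theorem integral_ball_rootFormDeriv {f S : ℂ → ℂ} {w α β v' v : ℂ} (h : IsAxisPair v' v)
    (hf : ACL f (Metric.ball 0 1))
    (hS : ContinuousOn S {0}ᶜ) (hsq : ∀ z ≠ 0, z * S z ^ 2 = f z + w) (hS0 : ∀ z ≠ 0, S z ≠ 0)
    (hint : IntegrableOn (rootFormDeriv f S α β v) (Metric.ball 0 1)) :
    ∫ z in Metric.ball (0 : ℂ) 1, rootFormDeriv f S α β v z =
      ∫ s in (-1 : ℝ)..1,
        (S (s * v' + √(1 - s ^ 2) * v) * (α + β * (s * v' + √(1 - s ^ 2) * v)) -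
        S (s * v' - √(1 - s ^ 2) * v) * (α + β * (s * v' - √(1 - s ^ 2) * v))) := by
  set D := Metric.ball (0 : ℂ) 1 with hD
  set k := rootFormDeriv f S α β v with hk
  set Φ : ℝ × ℝ → ℂ := fun p => (p.1 : ℂ) * v' + p.2 * v with hΦ
  have hmp : MeasurePreserving Φ := h.measurePreserving
  have hind : Integrable (D.indicator k) := (integrable_indicator_iff measurableSet_ball).2 hint
  have hcomp : Integrable (fun p => D.indicator k (Φ p)) (volume.prod volume) := by
    have := hmp.integrable_comp_emb h.measurableEmbedding (g := D.indicator k)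
    exact this.2 hind
  have hslice : ∀ s : ℝ, (fun t : ℝ => D.indicator k (Φ (s, t))) =
      (Ioo (-√(1 - s ^ 2)) √(1 - s ^ 2)).indicator (fun t => k (s * v' + t * v)) := by
    intro s
    funext t
    have : Φ (s, t) ∈ D ↔ t ∈ Ioo (-√(1 - s ^ 2)) √(1 - s ^ 2) := by
      rw [hΦ, hD]
      simp only
      rw [h.mem_ball, mem_Ioo, ← abs_lt, Real.lt_sqrt (abs_nonneg _), sq_abs]
      constructor <;> intro <;> linarith
    by_cases ht : Φ (s, t) ∈ D
    · rw [indicator_of_mem ht, indicator_of_mem (this.1 ht)]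
    · rw [indicator_of_notMem ht, indicator_of_notMem (fun h' => ht (this.2 h'))]
  rw [← integral_indicator measurableSet_ball, ← hmp.integral_comp h.measurableEmbedding,
    Measure.volume_eq_prod, integral_prod _ hcomp,
    intervalIntegral.integral_of_le (by norm_num), integral_Ioc_eq_integral_Ioo,
    ← integral_indicator measurableSet_Ioo]
  refine integral_congr_ae ?_
  have hne : ∀ᵐ s : ℝ, s ≠ 0 := by simp [ae_iff]
  filter_upwards [hf.ae_chord h, hcomp.prod_right_ae, hne] with s hs hsint hs0
  rw [hslice] at hsint ⊢
  by_cases hs1 : s ∈ Ioo (-1 : ℝ) 1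
  · rw [indicator_of_mem hs1]
    have hs2 : s ^ 2 < 1 := by nlinarith [hs1.1, hs1.2]
    set m₀ := √(1 - s ^ 2) with hm₀
    have hm₀0 : 0 < m₀ := Real.sqrt_pos.2 (by linarith)
    have hm₀sq : m₀ ^ 2 = 1 - s ^ 2 := Real.sq_sqrt (by linarith)
    rw [integrable_indicator_iff measurableSet_Ioo] at hsint
    rw [integral_indicator measurableSet_Ioo, ← integral_Ioc_eq_integral_Ioo,
      ← intervalIntegral.integral_of_le (by linarith)]
    have hpc : Continuous fun t : ℝ => (s : ℂ) * v' + t * v := by fun_prop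
    have hn0 : ∀ t : ℝ, (‖(s : ℂ) * v' + t * v‖ : ℂ) ≠ 0 := fun t =>
      Complex.ofReal_ne_zero.2 (norm_ne_zero_iff.2 (h.ne_zero hs0 t))
    have hRc : Continuous fun t : ℝ => S (s * v' + t * v) *
        (α + β * ((s * v' + t * v) / ‖(s : ℂ) * v' + t * v‖)) := by
      have h1 : Continuous fun t : ℝ => S (s * v' + t * v) :=
        hS.comp_continuous hpc fun t => h.ne_zero hs0 t
      have h2 : Continuous fun t : ℝ => (s * v' + t * v) / (‖(s : ℂ) * v' + t * v‖ : ℂ) :=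
        hpc.div (by fun_prop) hn0
      exact h1.mul (continuous_const.add (continuous_const.mul h2))
    have hii : IntervalIntegrable (fun t : ℝ => k (s * v' + t * v)) volume (-m₀) m₀ := by
      rw [intervalIntegrable_iff_integrableOn_Ioo_of_le (by linarith)]
      exact hsint
    rw [intervalIntegral_eq_sub_of_forall_lt hm₀0 hii hRc.continuousOn fun m hm =>
      (integral_rootFormDeriv hS hsq hS0 (h.ne_zero hs0) (hs m (by nlinarith [hm.1, hm.2]))).2]
    have hnorm : ∀ t : ℝ, t ^ 2 = m₀ ^ 2 → ‖(s : ℂ) * v' + t * v‖ = 1 := by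
      intro t ht
      have := h.norm_sq s t
      rw [ht, hm₀sq] at this
      nlinarith [norm_nonneg ((s : ℂ) * v' + t * v)]
    rw [hnorm _ rfl, hnorm _ (neg_sq m₀)]
    push_cast
    simp only [neg_mul, ← sub_eq_add_neg, div_one]
  · rw [indicator_of_notMem hs1]
    have : √(1 - s ^ 2) = 0 := by
      refine Real.sqrt_eq_zero_of_nonpos ?_
      by_contra! hlt
      exact hs1 (abs_lt.1 (by rw [← sq_lt_one_iff_abs_lt_one]; linarith))
    rw [this]
    simp

/-! ### Boundary integrals -/

theorem exp_mul_I_eq (θ : ℝ) : Complex.exp (θ * Complex.I) =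
    Real.cos θ + Real.sin θ * Complex.I := by
  rw [Complex.exp_mul_I, Complex.ofReal_cos, Complex.ofReal_sin]

/-- The boundary integral `∮ G dy` over the unit circle, as an integral over the heights `s` of the
horizontal chords. -/
theorem integral_chord_ends_eq {G : ℂ → ℂ} (hG : ContinuousOn G (Metric.sphere 0 1)) :
    ∫ s in (-1 : ℝ)..1, (G (s * Complex.I + √(1 - s ^ 2)) - G (s * Complex.I - √(1 - s ^ 2))) =
      ∫ θ in (0 : ℝ)..2 * Real.pi, G (Complex.exp (θ * Complex.I)) * Real.cos θ := by
  set u : ℝ → ℂ := fun θ => G (Complex.exp (θ * Complex.I)) * Real.cos θ with hu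
  have hGc : Continuous fun θ : ℝ => G (Complex.exp (θ * Complex.I)) :=
    hG.comp_continuous (by fun_prop) fun θ => by simp [Complex.norm_exp_ofReal_mul_I]
  have huc : Continuous u := by
    have : Continuous fun θ : ℝ => (Real.cos θ : ℂ) :=
      Complex.continuous_ofReal.comp Real.continuous_cos
    exact hGc.mul this
  have hper : Function.Periodic u (2 * Real.pi) := by
    intro θ
    have : Complex.exp (((θ + 2 * Real.pi : ℝ) : ℂ) * Complex.I) = Complex.exp (θ * Complex.I) := by
      push_cast
      rw [add_mul, Complex.exp_periodic]
    rw [hu]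
    simp only [this, Real.cos_add_two_pi]
  have hsphere : ∀ s ∈ Icc (-1 : ℝ) 1, ∀ x : ℝ, x ^ 2 = 1 - s ^ 2 →
      (s * Complex.I + x : ℂ) ∈ Metric.sphere (0 : ℂ) 1 := by
    intro s hs x hx
    rw [mem_sphere_zero_iff_norm, ← sq_eq_sq₀ (norm_nonneg _) zero_le_one,
      ← Complex.normSq_eq_norm_sq, Complex.normSq_apply]
    simp
    nlinarith
  have hsqrt : ∀ s ∈ Icc (-1 : ℝ) 1, √(1 - s ^ 2) ^ 2 = 1 - s ^ 2 := fun s hs =>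
    Real.sq_sqrt (by nlinarith [hs.1, hs.2])
  set w : ℝ → ℂ := fun s => G (s * Complex.I + √(1 - s ^ 2)) - G (s * Complex.I - √(1 - s ^ 2)) with hw
  have hwc : ContinuousOn w (Icc (-1) 1) := by
    refine ContinuousOn.sub ?_ ?_
    · exact hG.comp (Continuous.continuousOn (by fun_prop)) fun s hs => hsphere s hs _ (hsqrt s hs)
    · refine hG.comp (Continuous.continuousOn (by fun_prop)) fun s hs => ?_
      have := hsphere s hs (-√(1 - s ^ 2)) (by rw [neg_sq]; exact hsqrt s hs)
      rwa [Complex.ofReal_neg, ← sub_eq_add_neg] at this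
  have hsub : ∫ θ in (-(Real.pi / 2))..(Real.pi / 2), Real.cos θ • w (Real.sin θ) =
      ∫ s in (-1 : ℝ)..1, w s := by
    have := intervalIntegral.integral_deriv_smul_comp'' (a := -(Real.pi / 2)) (b := Real.pi / 2)
      (f := Real.sin) (f' := Real.cos) (g := w) Real.continuous_sin.continuousOn
      (fun x _ => (Real.hasDerivAt_sin x).hasDerivWithinAt) Real.continuous_cos.continuousOn
      (hwc.mono (by rintro _ ⟨x, _, rfl⟩; exact Real.sin_mem_Icc x))
    simpa [Real.sin_pi_div_two] using this
  have hcongr : ∫ θ in (-(Real.pi / 2))..(Real.pi / 2), Real.cos θ • w (Real.sin θ) =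
      ∫ θ in (-(Real.pi / 2))..(Real.pi / 2), (u θ + u (Real.pi - θ)) := by
    refine intervalIntegral.integral_congr fun θ hθ => ?_
    rw [uIcc_of_le (by linarith [Real.pi_pos])] at hθ
    have hcos : 0 ≤ Real.cos θ := Real.cos_nonneg_of_mem_Icc hθ
    have h1 : √(1 - Real.sin θ ^ 2) = Real.cos θ := by
      rw [← Real.cos_sq', Real.sqrt_sq hcos]
    have e1 : Complex.exp (θ * Complex.I) = Real.sin θ * Complex.I + Real.cos θ := by
      rw [exp_mul_I_eq]; ring
    have e2 : Complex.exp (((Real.pi - θ : ℝ) : ℂ) * Complex.I) =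
        Real.sin θ * Complex.I - Real.cos θ := by
      rw [exp_mul_I_eq, Real.cos_pi_sub, Real.sin_pi_sub]; push_cast; ring
    simp only [hu, hw, h1, e1, e2, Real.cos_pi_sub, Complex.real_smul]
    push_cast
    ring
  have hrefl : ∫ θ in (-(Real.pi / 2))..(Real.pi / 2), u (Real.pi - θ) =
      ∫ θ in (Real.pi / 2)..(-(Real.pi / 2) + 2 * Real.pi), u θ := by
    rw [intervalIntegral.integral_comp_sub_left]
    congr 1 <;> ring
  have hi : ∀ a b, IntervalIntegrable u volume a b := fun a b => huc.intervalIntegrable a b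
  rw [← hsub, hcongr, intervalIntegral.integral_add (hi _ _)
    (Continuous.intervalIntegrable (u := fun θ => u (Real.pi - θ)) (by fun_prop) _ _), hrefl,
    intervalIntegral.integral_add_adjacent_intervals (hi _ _) (hi _ _),
    hper.intervalIntegral_add_eq (-(Real.pi / 2)) 0, zero_add]

/-- The boundary integral `∮ G dx`, as an integral over the vertical chords. -/
theorem integral_chord_ends_eq' {G : ℂ → ℂ} (hG : ContinuousOn G (Metric.sphere 0 1)) :
    ∫ s in (-1 : ℝ)..1, (G (s + √(1 - s ^ 2) * Complex.I) - G (s - √(1 - s ^ 2) * Complex.I)) =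
      ∫ θ in (0 : ℝ)..2 * Real.pi, G (Complex.exp (θ * Complex.I)) * Real.sin θ := by
  -- Reflect in the diagonal.
  have hG' : ContinuousOn (fun z => G (Complex.I * conj z)) (Metric.sphere 0 1) :=
    hG.comp (Continuous.continuousOn (by fun_prop)) fun z hz => by simpa using hz
  have h1 := integral_chord_ends_eq hG'
  set u : ℝ → ℂ := fun θ => G (Complex.exp (θ * Complex.I)) * Real.sin θ with hu
  have hper : Function.Periodic u (2 * Real.pi) := by
    intro θ
    have : Complex.exp (((θ + 2 * Real.pi : ℝ) : ℂ) * Complex.I) = Complex.exp (θ * Complex.I) := by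
      push_cast
      rw [add_mul, Complex.exp_periodic]
    rw [hu]
    simp only [this, Real.sin_add_two_pi]
  have h2 : ∀ θ : ℝ, G (Complex.I * conj (Complex.exp (θ * Complex.I))) * Real.cos θ =
      u (Real.pi / 2 - θ) := by
    intro θ
    have : Complex.I * conj (Complex.exp (θ * Complex.I)) =
        Complex.exp (((Real.pi / 2 - θ : ℝ) : ℂ) * Complex.I) := by
      rw [exp_mul_I_eq, exp_mul_I_eq, Real.cos_pi_div_two_sub, Real.sin_pi_div_two_sub]
      simp only [map_add, map_mul, Complex.conj_ofReal, Complex.conj_I]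
      linear_combination -(Real.sin θ : ℂ) * Complex.I_sq
    rw [hu, this]
    simp only [Real.sin_pi_div_two_sub]
  simp only [h2] at h1
  rw [intervalIntegral.integral_comp_sub_left] at h1
  have h3 := hper.intervalIntegral_add_eq (Real.pi / 2 - 2 * Real.pi) 0
  rw [zero_add, sub_add_cancel] at h3
  rw [sub_zero, h3] at h1
  rw [← h1]
  congr 1
  funext s
  have e1 : Complex.I * conj ((s : ℂ) * Complex.I + (√(1 - s ^ 2) : ℝ)) =
      s + √(1 - s ^ 2) * Complex.I := by
    simp only [map_add, map_mul, Complex.conj_ofReal, Complex.conj_I]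
    linear_combination -(s : ℂ) * Complex.I_sq
  have e2 : Complex.I * conj ((s : ℂ) * Complex.I - (√(1 - s ^ 2) : ℝ)) =
      s - √(1 - s ^ 2) * Complex.I := by
    simp only [map_sub, map_mul, Complex.conj_ofReal, Complex.conj_I]
    linear_combination -(s : ℂ) * Complex.I_sq
  rw [e1, e2]

theorem one_add_mul_mem_slitPlane {r : ℝ} (hr0 : 0 ≤ r) (hr1 : r < 1) {z : ℂ} (hz : ‖z‖ ≤ 1) :
    1 + (r : ℂ) * z ∈ Complex.slitPlane := by
  left
  have h1 : ‖(r : ℂ) * z‖ ≤ r := by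
    rw [norm_mul, Complex.norm_real, Real.norm_of_nonneg hr0]
    exact mul_le_of_le_one_right hr0 hz
  have h2 := (abs_le.1 (Complex.abs_re_le_norm ((r : ℂ) * z))).1
  rw [Complex.add_re, Complex.one_re]
  linarith

/-- With `ψ z = √(1 + r z)`, the integral is `2 π (ψ 0 + ψ' 0)` by Cauchy's formula. -/
theorem integral_sqrt_one_add {r : ℝ} (hr0 : 0 ≤ r) (hr1 : r < 1) :
    ∫ θ in (0 : ℝ)..2 * Real.pi,
      Complex.exp (Complex.log (1 + r * (Complex.exp (θ * Complex.I))⁻¹) / 2) *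
        (Complex.exp (θ * Complex.I) + 1) = 2 * Real.pi * (1 + r / 2) := by
  set χ : ℂ → ℂ := fun z => Complex.exp (Complex.log (1 + r * z) / 2) * (1 + z) with hχ
  have hd : ∀ z : ℂ, ‖z‖ ≤ 1 → HasDerivAt χ
      (Complex.exp (Complex.log (1 + r * z) / 2) * (r / (1 + r * z) / 2) * (1 + z) +
        Complex.exp (Complex.log (1 + r * z) / 2) * 1) z := by
    intro z hz
    have h1 : HasDerivAt (fun z : ℂ => 1 + (r : ℂ) * z) r z := by
      simpa using ((hasDerivAt_id z).const_mul (r : ℂ)).const_add 1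
    have h2 := ((h1.clog (one_add_mul_mem_slitPlane hr0 hr1 hz)).div_const 2).cexp
    exact h2.mul ((hasDerivAt_id z).const_add 1)
  have hdc : DiffContOnCl ℂ χ (Metric.ball 0 1) := by
    refine DifferentiableOn.diffContOnCl ?_
    rw [closure_ball _ one_ne_zero]
    exact fun z hz => (hd z (by simpa using hz)).differentiableAt.differentiableWithinAt
  have hcauchy := hdc.deriv_eq_smul_circleIntegral one_pos
  rw [(hd 0 (by simp)).deriv, circleIntegral] at hcauchy
  set k : ℝ → ℂ := fun θ => Complex.exp (Complex.log (1 + r * Complex.exp (θ * Complex.I)) / 2) *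
    ((Complex.exp (θ * Complex.I))⁻¹ + 1) with hk
  have hintegrand : ∀ θ : ℝ, deriv (circleMap 0 1) θ • (1 / (circleMap 0 1 θ - 0) ^ 2) •
      χ (circleMap 0 1 θ) = Complex.I * k θ := by
    intro θ
    have hE : Complex.exp (θ * Complex.I) ≠ 0 := Complex.exp_ne_zero _
    rw [deriv_circleMap, circleMap, hk, hχ]
    simp only [Complex.ofReal_one, one_mul, zero_add, sub_zero, smul_eq_mul]
    field_simp
  simp only [hintegrand] at hcauchy
  rw [intervalIntegral.integral_const_mul] at hcauchy
  have hval : ∫ θ in (0 : ℝ)..2 * Real.pi, k θ = 2 * Real.pi * (1 + r / 2) := by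
    apply mul_left_cancel₀ Complex.I_ne_zero
    rw [hcauchy]
    simp
    ring
  have hper : Function.Periodic k (2 * Real.pi) := by
    intro θ
    have : Complex.exp (((θ + 2 * Real.pi : ℝ) : ℂ) * Complex.I) = Complex.exp (θ * Complex.I) := by
      push_cast
      rw [add_mul, Complex.exp_periodic]
    rw [hk]
    simp only [this]
  have hneg : ∀ θ : ℝ, Complex.exp (Complex.log (1 + r * (Complex.exp (θ * Complex.I))⁻¹) / 2) *
        (Complex.exp (θ * Complex.I) + 1) = k (-θ) := by
    intro θ
    rw [hk]
    simp only [Complex.ofReal_neg, neg_mul, Complex.exp_neg, inv_inv]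
  simp only [hneg]
  have h3 := hper.intervalIntegral_add_eq (-(2 * Real.pi)) 0
  rw [zero_add, neg_add_cancel] at h3
  rw [intervalIntegral.integral_comp_neg, neg_zero, h3, hval]

/-! ### Green's formula and pointwise bounds -/

/-- The curl of the vector field `(P, Q) = (-(i/4) S (1 - z/|z|), (1/4) S (1 + z/|z|))`. With
`w = √z` and `F = √(f z + r)`, so that `S = F / w`, the one-form `P dx + Q dy` is
`F d(Im w)`. All terms that do not contain a derivative of `f` cancel. -/
theorem rootFormDeriv_sub_eq {f S : ℂ → ℂ} {z : ℂ} (hz : z ≠ 0) (hS0 : S z ≠ 0) :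
    rootFormDeriv f S (1 / 4) (1 / 4) 1 z -
      rootFormDeriv f S (-Complex.I / 4) (Complex.I / 4) Complex.I z =
    (dzbar f z / (z * S z) + dz f z / (‖z‖ * S z)) / 4 := by
  have hn : (‖z‖ : ℂ) ≠ 0 := by simpa using hz
  have h1 : ((z * conj (1 : ℂ)).re : ℂ) - Complex.I * (z * conj Complex.I).re = conj z := by
    apply Complex.ext <;> simp
  have h2 : z * conj z = (‖z‖ : ℂ) ^ 2 := by
    rw [Complex.mul_conj, Complex.normSq_eq_norm_sq]; push_cast; ring
  rw [rootFormDeriv, rootFormDeriv, dzbar, dz]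
  set A : ℂ := ((z * conj (1 : ℂ)).re : ℂ)
  set B : ℂ := ((z * conj Complex.I).re : ℂ)
  set n : ℂ := (‖z‖ : ℂ)
  set a := lineDeriv ℝ f z 1
  set b := lineDeriv ℝ f z Complex.I
  have h3 : z * (A - Complex.I * B) = n ^ 2 := by rw [h1, h2]
  generalize S z = σ at *
  clear_value A B n a b
  field_simp
  linear_combination (-σ ^ 2 * n ^ 2 * z - σ ^ 2 * n ^ 3) * Complex.I_sq - 2 * σ ^ 2 * z * h3

theorem norm_lineDeriv_one_le (f : ℂ → ℂ) (z : ℂ) :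
    ‖lineDeriv ℝ f z 1‖ ≤ ‖dz f z‖ + ‖dzbar f z‖ := by
  have : lineDeriv ℝ f z 1 = dz f z + dzbar f z := by rw [dz, dzbar]; ring
  rw [this]
  exact norm_add_le _ _

theorem norm_lineDeriv_I_le (f : ℂ → ℂ) (z : ℂ) :
    ‖lineDeriv ℝ f z Complex.I‖ ≤ ‖dz f z‖ + ‖dzbar f z‖ := by
  have : lineDeriv ℝ f z Complex.I = Complex.I * (dz f z - dzbar f z) := by
    rw [dz, dzbar]
    linear_combination lineDeriv ℝ f z Complex.I * Complex.I_sq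
  rw [this, norm_mul, Complex.norm_I, one_mul]
  exact norm_sub_le _ _

theorem norm_rootFormDeriv_le {f S : ℂ → ℂ} {α β v z : ℂ} {d : ℝ} (hz : z ≠ 0) (hS0 : S z ≠ 0)
    (hv : ‖v‖ = 1) (hα : ‖α‖ ≤ 1 / 4) (hβ : ‖β‖ ≤ 1 / 4) (hd : ‖lineDeriv ℝ f z v‖ ≤ d) :
    ‖rootFormDeriv f S α β v z‖ ≤ d / (‖z‖ * ‖S z‖) + ‖S z‖ / ‖z‖ := by
  have hz0 : 0 < ‖z‖ := norm_pos_iff.2 hz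
  have hs0 : 0 < ‖S z‖ := norm_pos_iff.2 hS0
  have h1 : ‖α + β * (z / ‖z‖)‖ ≤ 1 / 2 := by
    refine (norm_add_le _ _).trans ?_
    rw [norm_mul, norm_div, Complex.norm_real, norm_norm, div_self hz0.ne']
    linarith
  have h2 : ‖lineDeriv ℝ f z v - v * S z ^ 2‖ ≤ d + ‖S z‖ ^ 2 := by
    refine (norm_sub_le _ _).trans ?_
    rw [norm_mul, hv, one_mul, norm_pow]
    gcongr
  have h3 : ‖β * (v / ‖z‖ - z * ((z * conj v).re : ℂ) / (‖z‖ : ℂ) ^ 3)‖ ≤ 1 / 2 * (1 / ‖z‖) := by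
    have h4 : ‖v / ‖z‖ - z * ((z * conj v).re : ℂ) / (‖z‖ : ℂ) ^ 3‖ ≤ 2 / ‖z‖ := by
      refine (norm_sub_le _ _).trans ?_
      rw [norm_div, norm_div, norm_mul, norm_pow, Complex.norm_real, Complex.norm_real, norm_norm, hv]
      have h5 : ‖(z * conj v).re‖ ≤ ‖z‖ := by
        refine (Complex.abs_re_le_norm _).trans ?_
        rw [norm_mul, RCLike.norm_conj, hv, mul_one]
      calc 1 / ‖z‖ + ‖z‖ * ‖(z * conj v).re‖ / ‖z‖ ^ 3 ≤ 1 / ‖z‖ + ‖z‖ * ‖z‖ / ‖z‖ ^ 3 := by gcongr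
        _ = 2 / ‖z‖ := by field_simp; norm_num
    rw [norm_mul]
    calc ‖β‖ * _ ≤ 1 / 4 * (2 / ‖z‖) := by gcongr
      _ = 1 / 2 * (1 / ‖z‖) := by ring
  have hd0 : 0 ≤ d := (norm_nonneg _).trans hd
  rw [rootFormDeriv]
  refine (norm_add_le _ _).trans ?_
  rw [norm_mul, norm_div, norm_mul (S z), norm_mul (2 * z), norm_mul 2, Complex.norm_ofNat]
  calc _ ≤ (d + ‖S z‖ ^ 2) / (2 * ‖z‖ * ‖S z‖) * (1 / 2) + ‖S z‖ * (1 / 2 * (1 / ‖z‖)) := by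
        gcongr
    _ = 1 / 4 * (d / (‖z‖ * ‖S z‖)) + 3 / 4 * (‖S z‖ / ‖z‖) := by field_simp; ring
    _ ≤ d / (‖z‖ * ‖S z‖) + ‖S z‖ / ‖z‖ := by
        have : 0 ≤ d / (‖z‖ * ‖S z‖) := by positivity
        have : 0 ≤ ‖S z‖ / ‖z‖ := by positivity
        linarith

theorem measurable_rootFormDeriv {f S : ℂ → ℂ} (hf : Continuous f) (hS : Measurable S)
    (α β v : ℂ) : Measurable (rootFormDeriv f S α β v) := by
  have h1 : Measurable fun z => lineDeriv ℝ f z v := measurable_lineDeriv hf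
  have h2 : Measurable fun z : ℂ => conj z := Complex.continuous_conj.measurable
  unfold rootFormDeriv
  fun_prop

/-- Green's theorem in the unit disc for the vector field of `rootFormDeriv_sub_eq`, with the
boundary values `S z = √(1 + r / z)`. -/
theorem integral_curl_eq {f S : ℂ → ℂ} {r : ℝ} (hr0 : 0 ≤ r) (hr1 : r < 1)
    (hf : ACL f (Metric.ball 0 1))
    (hS : ContinuousOn S {0}ᶜ) (hsq : ∀ z ≠ 0, z * S z ^ 2 = f z + r) (hS0 : ∀ z ≠ 0, S z ≠ 0)
    (hbd : ∀ z, ‖z‖ = 1 → S z = Complex.exp (Complex.log (1 + r * z⁻¹) / 2))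
    (h1 : IntegrableOn (rootFormDeriv f S (1 / 4) (1 / 4) 1) (Metric.ball 0 1))
    (h2 : IntegrableOn (rootFormDeriv f S (-Complex.I / 4) (Complex.I / 4) Complex.I)
      (Metric.ball 0 1)) :
    ∫ z in Metric.ball (0 : ℂ) 1, (rootFormDeriv f S (1 / 4) (1 / 4) 1 z -
      rootFormDeriv f S (-Complex.I / 4) (Complex.I / 4) Complex.I z) =
    Real.pi / 2 * (1 + r / 2) := by
  rw [integral_sub h1 h2,
    integral_ball_rootFormDeriv (Or.inl ⟨rfl, rfl⟩) hf hS hsq hS0 h1,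
    integral_ball_rootFormDeriv (Or.inr ⟨rfl, rfl⟩) hf hS hsq hS0 h2]
  have hSs : ContinuousOn S (Metric.sphere 0 1) := hS.mono fun z hz h => by
    rw [mem_singleton_iff] at h
    simp [h] at hz
  have hc : ∀ α β : ℂ, ContinuousOn (fun z => S z * (α + β * z)) (Metric.sphere 0 1) :=
    fun α β => hSs.mul (Continuous.continuousOn (by fun_prop))
  have e1 := integral_chord_ends_eq (hc (1 / 4) (1 / 4))
  have e2 := integral_chord_ends_eq' (hc (-Complex.I / 4) (Complex.I / 4))
  simp only [mul_one] at e1 e2 ⊢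
  rw [e1, e2, ← intervalIntegral.integral_sub]
  · have h : ∀ θ : ℝ, S (Complex.exp (θ * Complex.I)) *
          (1 / 4 + 1 / 4 * Complex.exp (θ * Complex.I)) * Real.cos θ -
        S (Complex.exp (θ * Complex.I)) *
          (-Complex.I / 4 + Complex.I / 4 * Complex.exp (θ * Complex.I)) * Real.sin θ =
        1 / 4 * (Complex.exp (Complex.log (1 + r * (Complex.exp (θ * Complex.I))⁻¹) / 2) *
        (Complex.exp (θ * Complex.I) + 1)) := by
      intro θ
      rw [← hbd _ (Complex.norm_exp_ofReal_mul_I θ), exp_mul_I_eq]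
      have hcs : (Real.cos θ : ℂ) ^ 2 + (Real.sin θ : ℂ) ^ 2 = 1 := by
        exact_mod_cast Real.cos_sq_add_sin_sq θ
      generalize S _ = σ
      generalize (Real.cos θ : ℂ) = c at *
      generalize (Real.sin θ : ℂ) = s at *
      linear_combination σ / 4 * hcs - σ / 4 * s ^ 2 * Complex.I_sq
    simp only [h]
    rw [intervalIntegral.integral_const_mul, integral_sqrt_one_add hr0 hr1]
    ring
  all_goals
    refine Continuous.intervalIntegrable (Continuous.mul ?_ ?_) _ _
    · exact (hc _ _).comp_continuous (by fun_prop) fun θ => by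
        simp [Complex.norm_exp_ofReal_mul_I]
    · first
      | exact Complex.continuous_ofReal.comp Real.continuous_cos
      | exact Complex.continuous_ofReal.comp Real.continuous_sin

/-! ### The displacement bound -/

/-- The displacement bound in terms of any constant `K` that dominates the dilatation. -/
theorem one_add_half_le_sqrt {f : ℂ → ℂ} {r K : ℝ} (hf : Continuous f)
    (hout : ∀ z, 1 ≤ ‖z‖ → f z = z) (hinj : InjOn f (Metric.ball 0 1))
    (himg : f '' Metric.ball 0 1 = Metric.ball 0 1) (hr0 : 0 ≤ r) (hr1 : r < 1)
    (h0 : f 0 = -r) (hacl : ACL f (Metric.ball 0 1)) (hK : 0 < K)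
    (hdil : ∀ᵐ z ∂volume.restrict (Metric.ball (0 : ℂ) 1),
      (‖dz f z‖ + ‖dzbar f z‖) ^ 2 ≤ K * (‖dz f z‖ ^ 2 - ‖dzbar f z‖ ^ 2)) :
    1 + r / 2 ≤ √K := by
  set D := Metric.ball (0 : ℂ) 1 with hD
  have hne : ∀ z ≠ 0, f z + r ≠ 0 := by
    intro z hz h
    rcases lt_or_ge ‖z‖ 1 with h1 | h1
    · refine hz (hinj (by simpa [hD] using h1) (by simp [hD]) ?_)
      rw [h0]
      exact eq_neg_of_add_eq_zero_left h
    · rw [hout z h1] at h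
      rw [eq_neg_of_add_eq_zero_left h, norm_neg, Complex.norm_real, Real.norm_of_nonneg hr0] at h1
      linarith
  obtain ⟨S, hS, hsq, hbd⟩ := exists_sqrt_div hf hr0 hr1 hout hne
  have hS0 : ∀ z ≠ 0, S z ≠ 0 := by
    intro z hz h
    apply hne z hz
    rw [← hsq z hz, h]
    simp
  have hSm : Measurable S := measurable_of_continuousOn_compl_singleton 0 hS
  have hnz : ∀ᵐ z ∂volume.restrict D, z ≠ 0 := by
    refine ae_restrict_of_ae ?_
    simp [ae_iff]
  have hnormsq : ∀ z ≠ 0, ‖z‖ * ‖S z‖ ^ 2 = ‖f z + r‖ := fun z hz => by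
    rw [← hsq z hz, norm_mul, norm_pow]
  set J : ℂ → ℝ := fun z => ‖dz f z‖ ^ 2 - ‖dzbar f z‖ ^ 2 with hJ
  set d : ℂ → ℝ := fun z => ‖dz f z‖ + ‖dzbar f z‖ with hd
  -- The area inequality, with the weight `1 / |w + r|` on the image side.
  have harea : ∫⁻ z in D, ENNReal.ofReal (J z) * ENNReal.ofReal ‖f z + r‖⁻¹ ≤
      ENNReal.ofReal (2 * Real.pi) := by
    refine (lintegral_jacobian_mul_le hf measurableSet_ball measure_ball_lt_top.ne hinj
      (hacl.ae_lineDifferentiableAt hf (Or.inl ⟨rfl, rfl⟩))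
      (hacl.ae_lineDifferentiableAt hf (Or.inr ⟨rfl, rfl⟩))
      fun w => ENNReal.ofReal ‖w + r‖⁻¹).trans ?_
    rw [himg]
    exact lintegral_inv_norm_add_ball_le r
  have hdisc : ∫⁻ z in D, ENNReal.ofReal ‖z‖⁻¹ = ENNReal.ofReal (2 * Real.pi) := by
    have := lintegral_norm_rpow_ball (s := -1) (by norm_num)
    simp only [Real.rpow_neg_one] at this
    rw [this]
    norm_num
  -- The arithmetic-geometric mean inequality, in place of the Cauchy-Schwarz inequality.
  have hmain : ∫⁻ z in D, ENNReal.ofReal (d z / (‖z‖ * ‖S z‖)) ≤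
      ENNReal.ofReal (2 * Real.pi * √K) := by
    calc ∫⁻ z in D, ENNReal.ofReal (d z / (‖z‖ * ‖S z‖))
        ≤ ∫⁻ z in D, ENNReal.ofReal (√K / 2) *
            (ENNReal.ofReal ‖z‖⁻¹ + ENNReal.ofReal (J z) * ENNReal.ofReal ‖f z + r‖⁻¹) := by
          refine lintegral_mono_ae ?_
          filter_upwards [hdil, hnz] with z hz hz0
          have hp : 0 < ‖z‖ := norm_pos_iff.2 hz0
          have hs : 0 < ‖S z‖ := norm_pos_iff.2 (hS0 z hz0)
          have hk : 0 < √K := Real.sqrt_pos.2 hK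
          have hksq : √K ^ 2 = K := Real.sq_sqrt hK.le
          have hz : d z ^ 2 ≤ K * J z := hz
          have hJ0 : 0 ≤ J z := by
            by_contra! hlt
            nlinarith [sq_nonneg (d z), mul_neg_of_pos_of_neg hK hlt]
          rw [← ENNReal.ofReal_mul hJ0, ← ENNReal.ofReal_add (by positivity) (by positivity),
            ← ENNReal.ofReal_mul (by positivity), ← hnormsq z hz0]
          refine ENNReal.ofReal_le_ofReal ?_
          have e : √K / 2 * (‖z‖⁻¹ + J z * (‖z‖ * ‖S z‖ ^ 2)⁻¹) =
              (√K * (‖S z‖ ^ 2 + J z) / (2 * ‖S z‖)) / (‖z‖ * ‖S z‖) := by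
            field_simp
          rw [e]
          gcongr
          rw [le_div_iff₀ (by positivity), ← mul_le_mul_iff_right₀ hk]
          nlinarith [sq_nonneg (d z - √K * ‖S z‖)]
      _ ≤ ENNReal.ofReal (√K / 2) *
            (ENNReal.ofReal (2 * Real.pi) + ENNReal.ofReal (2 * Real.pi)) := by
          rw [lintegral_const_mul' _ _ ENNReal.ofReal_ne_top, lintegral_add_left (by fun_prop),
            hdisc]
          gcongr
      _ = ENNReal.ofReal (2 * Real.pi * √K) := by
          rw [← ENNReal.ofReal_add (by positivity) (by positivity),
            ← ENNReal.ofReal_mul (by positivity)]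
          congr 1
          ring
  have hSz : ∫⁻ z in D, ENNReal.ofReal (‖S z‖ / ‖z‖) < ∞ := by
    have hfin := lintegral_norm_rpow_ball (s := -(3 / 2)) (by norm_num)
    calc ∫⁻ z in D, ENNReal.ofReal (‖S z‖ / ‖z‖)
        ≤ ∫⁻ z in D, ENNReal.ofReal 2 * ENNReal.ofReal (‖z‖ ^ (-(3 / 2) : ℝ)) := by
          refine lintegral_mono_ae ?_
          filter_upwards [hnz, ae_restrict_mem measurableSet_ball] with z hz0 hzD
          have hp : 0 < ‖z‖ := norm_pos_iff.2 hz0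
          rw [← ENNReal.ofReal_mul zero_le_two]
          refine ENNReal.ofReal_le_ofReal ?_
          have hfz : ‖f z‖ < 1 := by
            have : f z ∈ D := himg.subset (mem_image_of_mem f hzD)
            simpa [hD] using this
          have h2 : ‖z‖ * ‖S z‖ ^ 2 ≤ 2 := by
            rw [hnormsq z hz0]
            refine (norm_add_le _ _).trans ?_
            rw [Complex.norm_real, Real.norm_of_nonneg hr0]
            linarith
          rw [div_le_iff₀ hp, mul_assoc, ← Real.rpow_add_one hp.ne']
          refine (sq_le_sq₀ (norm_nonneg _) (by positivity)).1 ?_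
          rw [mul_pow, ← Real.rpow_mul_natCast hp.le]
          norm_num
          rw [Real.rpow_neg_one, ← div_eq_mul_inv, le_div_iff₀ hp]
          linarith
      _ < ∞ := by
          rw [lintegral_const_mul' _ _ ENNReal.ofReal_ne_top, hfin]
          exact ENNReal.mul_lt_top ENNReal.ofReal_lt_top ENNReal.ofReal_lt_top
  have hintegrable : ∀ α β v : ℂ, ‖v‖ = 1 → ‖α‖ ≤ 1 / 4 → ‖β‖ ≤ 1 / 4 →
      (∀ z, ‖lineDeriv ℝ f z v‖ ≤ d z) → IntegrableOn (rootFormDeriv f S α β v) D := by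
    intro α β v hv hα hβ hle
    refine ⟨(measurable_rootFormDeriv hf hSm α β v).aestronglyMeasurable, ?_⟩
    rw [hasFiniteIntegral_iff_norm]
    calc ∫⁻ z in D, ENNReal.ofReal ‖rootFormDeriv f S α β v z‖
        ≤ ∫⁻ z in D, (ENNReal.ofReal (d z / (‖z‖ * ‖S z‖)) + ENNReal.ofReal (‖S z‖ / ‖z‖)) := by
          refine lintegral_mono_ae ?_
          filter_upwards [hnz] with z hz0
          refine (ENNReal.ofReal_le_ofReal (norm_rootFormDeriv_le hz0 (hS0 z hz0) hv hα hβ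
            (hle z))).trans ENNReal.ofReal_add_le
      _ < ∞ := by
          rw [lintegral_add_right _ (by fun_prop)]
          exact ENNReal.add_lt_top.2 ⟨hmain.trans_lt ENNReal.ofReal_lt_top, hSz⟩
  have hstokes := integral_curl_eq hr0 hr1 hacl hS hsq hS0 hbd
    (hintegrable _ _ 1 (by simp) (by norm_num) (by norm_num) (norm_lineDeriv_one_le f))
    (hintegrable _ _ Complex.I (by simp) (by norm_num) (by norm_num) (norm_lineDeriv_I_le f))
  have hbound := enorm_integral_le_lintegral_enorm (μ := volume.restrict D)
    (fun z => rootFormDeriv f S (1 / 4) (1 / 4) 1 z -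
      rootFormDeriv f S (-Complex.I / 4) (Complex.I / 4) Complex.I z)
  rw [hstokes] at hbound
  have hle : ∫⁻ z in D, ‖rootFormDeriv f S (1 / 4) (1 / 4) 1 z -
      rootFormDeriv f S (-Complex.I / 4) (Complex.I / 4) Complex.I z‖ₑ ≤
      ENNReal.ofReal (1 / 4) * ENNReal.ofReal (2 * Real.pi * √K) := by
    refine le_trans ?_ (mul_le_mul_right hmain _)
    rw [← lintegral_const_mul' _ _ ENNReal.ofReal_ne_top]
    refine lintegral_mono_ae ?_
    filter_upwards [hnz] with z hz0
    rw [rootFormDeriv_sub_eq hz0 (hS0 z hz0), ← ofReal_norm,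
      ← ENNReal.ofReal_mul (by norm_num)]
    refine ENNReal.ofReal_le_ofReal ?_
    rw [norm_div, Complex.norm_ofNat]
    have := norm_add_le (dzbar f z / (z * S z)) (dz f z / (‖z‖ * S z))
    rw [norm_div, norm_div, norm_mul, norm_mul, Complex.norm_real, norm_norm] at this
    calc _ ≤ (‖dzbar f z‖ / (‖z‖ * ‖S z‖) + ‖dz f z‖ / (‖z‖ * ‖S z‖)) / 4 := by gcongr
      _ = 1 / 4 * (d z / (‖z‖ * ‖S z‖)) := by rw [hd]; ring
  have hfinal := hbound.trans hle
  have hcast : (Real.pi / 2 * (1 + r / 2) : ℂ) = ((Real.pi / 2 * (1 + r / 2) : ℝ) : ℂ) := by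
    push_cast; ring
  have hpi := Real.pi_pos
  rw [hcast, ← ofReal_norm, Complex.norm_real, Real.norm_of_nonneg (by positivity),
    ← ENNReal.ofReal_mul (by norm_num), ENNReal.ofReal_le_ofReal_iff (by positivity)] at hfinal
  nlinarith

/-- Clearing denominators in the pointwise dilatation. At points where both Wirtinger derivatives
vanish the ratio is `0 / 0 = 0`, and the conclusion still holds. -/
theorem dilatation_le_of_ratio_le {a b k K : ℝ} (hb : 0 ≤ b) (hk : k < 1)
    (hab : b ≤ k * a) (ha : 0 ≤ a) (hK : (a + b) / (a - b) ≤ K) :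
    (a + b) ^ 2 ≤ K * (a ^ 2 - b ^ 2) := by
  rcases ha.eq_or_lt with h | h
  · rw [← h] at hab ⊢
    have : b = 0 := by linarith
    simp [this]
  · have hlt : 0 < a - b := by nlinarith
    rw [div_le_iff₀ hlt] at hK
    nlinarith

theorem mainTheorem3 (f : ℂ → ℂ)
    (hqc : IsQuasiconformalOn f (Metric.ball 0 1))
    (himage : f '' Metric.ball 0 1 = Metric.ball 0 1)
    (hcont : ContinuousOn f (Metric.closedBall 0 1))
    (hbdry : ∀ z ∈ Metric.sphere (0 : ℂ) 1, f z = z)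
    (hzero : f 0 ∈ (fun t : ℝ => (t : ℂ)) '' Ioc (-1 : ℝ) 0) :
    ‖f 0‖ ≤ 2 * (qcDilatation f (Metric.ball 0 1) ^ (1 / 2 : ℝ) - 1) := by
  obtain ⟨t, ht, hft⟩ := hzero
  obtain ⟨K₀, hK₀⟩ := hqc
  set K := qcDilatation f (Metric.ball 0 1) with hKdef
  -- Extend `f` by the identity outside the disc.
  set g : ℂ → ℂ := fun z => if ‖z‖ ≤ 1 then f z else z with hg
  have hgf : ∀ z, ‖z‖ ≤ 1 → g z = f z := fun z hz => if_pos hz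
  have hgout : ∀ z, 1 ≤ ‖z‖ → g z = z := by
    intro z hz
    rcases hz.eq_or_lt with h | h
    · rw [hgf z h.ge]
      exact hbdry z (by simpa using h.symm)
    · exact if_neg (not_le.2 h)
  have hgc : Continuous g := by
    refine continuous_if (fun z hz => ?_) ?_ continuousOn_id
    · have hle : {z : ℂ | ‖z‖ ≤ 1} = Metric.closedBall 0 1 := by ext; simp
      rw [hle, frontier_closedBall _ one_ne_zero] at hz
      exact hbdry z hz
    · refine hcont.mono ?_
      rw [(isClosed_le continuous_norm continuous_const).closure_eq]
      intro z hz
      simpa using hz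
  have hgball : EqOn g f (Metric.ball 0 1) := fun z hz => hgf z (by
    rw [mem_ball_zero_iff] at hz; exact hz.le)
  have hline : ∀ z ∈ Metric.ball (0 : ℂ) 1, ∀ v, lineDeriv ℝ g z v = lineDeriv ℝ f z v :=
    fun z hz v => Filter.EventuallyEq.lineDeriv_eq
      (Filter.eventuallyEq_of_mem (Metric.isOpen_ball.mem_nhds hz) hgball)
  have hdz : ∀ z ∈ Metric.ball (0 : ℂ) 1, dz g z = dz f z := fun z hz => by
    rw [dz, dz, hline z hz, hline z hz]
  have hdzbar : ∀ z ∈ Metric.ball (0 : ℂ) 1, dzbar g z = dzbar f z := fun z hz => by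
    rw [dzbar, dzbar, hline z hz, hline z hz]
  have hginj : InjOn g (Metric.ball 0 1) := by
    have : InjOn f (Metric.ball 0 1) := injOn_iff_injective.2 hK₀.homeo.injective
    exact this.congr hgball.symm
  have hgimg : g '' Metric.ball 0 1 = Metric.ball 0 1 := by
    rw [hgball.image_eq, himage]
  have hg0 : g 0 = -((-t : ℝ) : ℂ) := by
    rw [hgf 0 (by simp), ← hft]
    simp
  have hgacl : ACL g (Metric.ball 0 1) := by
    intro a b c d hab hcd hsub
    obtain ⟨h1, h2⟩ := hK₀.acl a b c d hab hcd hsub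
    constructor
    · filter_upwards [h1] with y hy hyc
      refine (hy hyc).congr ?_
      intro x hx
      rw [uIcc_of_le hab.le] at hx
      exact hgball (hsub (by simpa [Complex.mem_reProdIm] using ⟨hx, hyc⟩))
    · filter_upwards [h2] with x hx hxc
      refine (hx hxc).congr ?_
      intro y hy
      rw [uIcc_of_le hcd.le] at hy
      exact hgball (hsub (by simpa [Complex.mem_reProdIm] using ⟨hxc, hy⟩))
  have hk1 : (K₀ - 1) / (K₀ + 1) < 1 := by
    rw [div_lt_one (by linarith [hK₀.one_le])]; linarith
  -- The essential supremum of an unbounded function would be the junk value `0`.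
  have hbdd : Filter.IsBoundedUnder (· ≤ ·) (ae (volume.restrict (Metric.ball (0 : ℂ) 1)))
      (fun z => (‖dz f z‖ + ‖dzbar f z‖) / (‖dz f z‖ - ‖dzbar f z‖)) := by
    refine ⟨K₀, ?_⟩
    rw [Filter.eventually_map]
    filter_upwards [hK₀.dilatation] with z hz
    have h1 := norm_nonneg (dzbar f z)
    rcases (norm_nonneg (dz f z)).eq_or_lt with h | h
    · rw [← h] at hz ⊢
      have : ‖dzbar f z‖ = 0 := by linarith
      rw [this]
      simp
      linarith [hK₀.one_le]
    · have hlt : 0 < ‖dz f z‖ - ‖dzbar f z‖ := by nlinarith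
      rw [div_le_iff₀ hlt]
      rw [div_mul_eq_mul_div, le_div_iff₀ (by linarith [hK₀.one_le])] at hz
      nlinarith
  have hess := ae_le_essSup hbdd
  have hdil : ∀ K' : ℝ, K ≤ K' → ∀ᵐ z ∂volume.restrict (Metric.ball (0 : ℂ) 1),
      (‖dz g z‖ + ‖dzbar g z‖) ^ 2 ≤ K' * (‖dz g z‖ ^ 2 - ‖dzbar g z‖ ^ 2) := by
    intro K' hKK'
    filter_upwards [hess, hK₀.dilatation, ae_restrict_mem measurableSet_ball] with z h1 h2 h3
    rw [hdz z h3, hdzbar z h3]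
    exact dilatation_le_of_ratio_le (norm_nonneg _) hk1 h2 (norm_nonneg _) (h1.trans hKK')
  have hmain : ∀ K' : ℝ, K ≤ K' → 0 < K' → 1 + -t / 2 ≤ √K' := fun K' hKK' hK' =>
    one_add_half_le_sqrt hgc hgout hginj hgimg (by linarith [ht.2]) (by linarith [ht.1]) hg0 hgacl
      hK' (hdil K' hKK')
  have hKpos : 0 < K := by
    by_contra! hneg
    -- The hypothesis `K ≤ 0` would allow every positive constant, and `1 / 4` is already too small.
    have h1 := hmain (1 / 4) (by linarith) (by norm_num)
    have h2 : √(1 / 4 : ℝ) ≤ 1 / 2 := Real.sqrt_le_iff.2 ⟨by norm_num, by norm_num⟩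
    linarith [ht.2]
  have hfin := hmain K le_rfl hKpos
  rw [← hft]
  simp only [Complex.norm_real, Real.norm_of_nonpos ht.2]
  rw [← Real.sqrt_eq_rpow]
  linarith
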